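/- Let $M$ be a closed (compact, without boundary) smooth manifold of dimension $n\ge 1$ with a Riemannian metric, and let $f\colon M\to M$ be of class $C^1$. For $x\in M$ put $$\|D_xf\|_{\mathrm{co}}=\min_{v\in T_xM,\ \|v\|=1}\|(D_xf)v\| ,$$ and call $x$ a critical point of $f$ if $D_xf$ is not surjective. Let $\Lambda\subseteq M$ be a set of periodic points of $f$ with $f(\Lambda)\subseteq\Lambda$ whose closure $\mathrm{Cl}(\Lambda)$ contains no critical point of $f$, and let $c>0$ be such that $$\limsup_{k\to+\infty}\frac1k\sum_{i=0}^{k-1}\log\|D_{f^i(x)}f\|_{\mathrm{co}}\ \ge\ c\qquad\text{for all }x\in\Lambda .$$ Then at least one of the following holds. 1. $f$ is uniformly expanding on $\mathrm{Cl}(\Lambda)$: there are $C>0$ and $\lambda>0$ such that $\|(D_xf^k)v\|\ge C\|v\|e^{k\lambda}$ for all $x\in\mathrm{Cl}(\Lambda)$, $v\in T_xM$ and $k\ge1$. 2. For every neighbourhood $V$ of $\mathrm{Cl}(\Lambda)$ in $M$ (equivalently, every $V$ that contains the $\eta$-neighbourhood of $\Lambda$ for some $\eta>0$), all real numbers $0<\gamma'<\gamma''<c$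 and every $T\in\mathbb N$ there is a periodic orbit $P\subseteq V$ of $f$, containing no critical point of $f$ and of minimal period $\tau\ge T$, and a point $p\in P$ such that $$\frac1\tau\sum_{i=0}^{\tau-1}\log\|D_{f^i(p)}f\|_{\mathrm{co}}<\gamma''$$ and $$\frac1k\sum_{i=1}^{k}\log\|D_{f^{\tau-i}(p)}f\|_{\mathrm{co}}>\gamma'\qquad\text{for all }k=1,\dots,\tau .$$ -/

import Mathlib

open Set Filter Topology Manifold Bundle
open scoped ContDiff

namespace C1Endo

/-- The co-norm (minimum norm) `min {‖T v‖ : ‖v‖ = 1}` of a linear map. -/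
noncomputable def conorm {E F : Type*} [NormedAddCommGroup E] [NormedSpace ℝ E]
    [NormedAddCommGroup F] [NormedSpace ℝ F] (T : E →L[ℝ] F) : ℝ :=
  sInf ((fun v : E => ‖T v‖) '' Metric.sphere (0 : E) 1)

/-- A critical point of a map of an `n`-manifold into itself: the derivative is not onto. -/
def IsCriticalPoint (n : ℕ) {M : Type*} [TopologicalSpace M]
    [ChartedSpace (EuclideanSpace ℝ (Fin n)) M] (f : M → M) (x : M) : Prop :=
  ¬ Function.Surjective (mfderiv (𝓡 n) (𝓡 n) f x)

/-- `log ‖D_x f‖_co`, for the norms on the tangent spaces given by a Riemannian metric;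
used only at noncritical points, where the co-norm is positive. -/
noncomputable def logConorm (n : ℕ) {M : Type*} [TopologicalSpace M]
    [ChartedSpace (EuclideanSpace ℝ (Fin n)) M] [IsManifold (𝓡 n) ∞ M]
    [RiemannianBundle (fun x : M => TangentSpace (𝓡 n) x)] (f : M → M) (x : M) : ℝ :=
  Real.log (conorm (mfderiv (𝓡 n) (𝓡 n) f x))

/-- `f` is uniformly expanding on `K`. -/
def UniformlyExpandingOn (n : ℕ) {M : Type*} [TopologicalSpace M]
    [ChartedSpace (EuclideanSpace ℝ (Fin n)) M] [IsManifold (𝓡 n) ∞ M]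
    [RiemannianBundle (fun x : M => TangentSpace (𝓡 n) x)] (f : M → M) (K : Set M) : Prop :=
  ∃ C > (0 : ℝ), ∃ lam > (0 : ℝ), ∀ x ∈ K, ∀ v : TangentSpace (𝓡 n) x, ∀ k : ℕ, 1 ≤ k →
    C * ‖v‖ * Real.exp (k * lam) ≤ ‖mfderiv (𝓡 n) (𝓡 n) (f^[k]) x v‖

end C1Endo

/-! Let φ be the logarithm of the co-norm of Df, with Birkhoff sums S_k, and let K = Cl(Λ). If every
point of K has an average above a₀ = γ'/2 at some time, compactness gives S_k ≥ k a₀ − D on K, hence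
uniform expansion. Otherwise some x₀ in K has S_k(x₀) ≤ k a₀ for all k ≥ 1. A periodic q in Λ near
x₀ then has low averages up to a long time N, yet averages at least c over its period m.

Take α midway between γ' and γ'' and put s_n = S_n(q) − nα, so that s_m > 0. A segment ending at a
record time of s has all final averages at least α (`backwardGood_of_record`), so f has a
contracting inverse branch along it (`exists_inverse_branch`). Between consecutive records s gains
at most C = sup |φ|. The bad stretch after time m forces a gap of more than N between two
consecutive records.

Further records lead from the end of this long edge back to its start, but their number depends on q
and each costs an excess C. So K is divided into finitely many small label classes, with N₀ labels
chosen before N. A shortest path in the graph of labels has at most N₀ edges (`exists_short_path`),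
and the contraction absorbs the jumps within classes (`IsBranch.comp`). The composed branch maps a
ball into itself, and its fixed point p is periodic. The total excess (N₀ + 1)C is negligible
against N, so the average stays below γ''. The orbit of p contains a stretch with averages below γ',
while every final segment averages more than γ'; this makes the minimal period large. -/

namespace C1Endo

/-! ### Combinatorics of paths and record times -/

/-- In a finite type, reachability is witnessed by a path with at most `Fintype.card α` steps. -/
theorem exists_short_path {α : Type*} [Fintype α] {r : α → α → Prop} {a b : α}
    (h : Relation.ReflTransGen r a b) :
    ∃ n ≤ Fintype.card α, ∃ w : ℕ → α, w 0 = a ∧ w n = b ∧ ∀ i < n, r (w i) (w (i + 1)) := by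
  classical
  have hex : ∃ n, ∃ w : ℕ → α, w 0 = a ∧ w n = b ∧ ∀ i < n, r (w i) (w (i + 1)) := by
    induction h with
    | refl => exact ⟨0, fun _ => a, rfl, rfl, by simp⟩
    | @tail b c _ hbc ih =>
      obtain ⟨n, w, h0, hn, hw⟩ := ih
      refine ⟨n + 1, fun i => if i ≤ n then w i else c, by simpa using h0, by simp, ?_⟩
      intro i hi
      rcases Nat.lt_succ_iff_lt_or_eq.1 hi with hi | rfl
      · simpa [hi.le, Nat.succ_le_of_lt hi] using hw i hi
      · simpa [hn] using hbc
  obtain ⟨w, h0, hn, hw⟩ := Nat.find_spec hex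
  refine ⟨Nat.find hex, ?_, w, h0, hn, hw⟩
  set n := Nat.find hex with hndef
  have hne : ∀ i j, i < j → j ≤ n → w i ≠ w j := by
    intro i j hij hjn heq
    have hlt : n - (j - i) < n := by omega
    -- A repeated vertex allows the loop between its two visits to be cut out, contradicting
    -- minimality.
    refine Nat.find_min hex hlt ⟨fun k => if k ≤ i then w k else w (k + (j - i)), ?_, ?_, ?_⟩
    · simpa using h0
    · by_cases hle : n - (j - i) ≤ i
      · have hj : n = j := by omega
        have hi : n - (j - i) = i := by omega
        simp only [hi, le_refl, if_true]
        rw [heq, ← hj, hn]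
      · have : n - (j - i) + (j - i) = n := by omega
        simp [hle, this, hn]
    · intro k hk
      by_cases hk1 : k + 1 ≤ i
      · simpa [hk1, (Nat.le_succ k).trans hk1] using hw k (by omega)
      · by_cases hk2 : k ≤ i
        · have hki : k = i := by omega
          subst hki
          have h1 : k + 1 + (j - k) = j + 1 := by omega
          simpa [h1, heq] using hw j (by omega)
        · have h1 : k + 1 + (j - i) = k + (j - i) + 1 := by omega
          simpa [hk1, hk2, h1] using hw (k + (j - i)) (by omega)
  have hinj : Function.Injective (fun i : Fin (n + 1) => w i) := by
    intro i j hij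
    by_contra hne'
    rcases lt_or_gt_of_ne (fun h => hne' (Fin.ext h) : (i : ℕ) ≠ j) with h | h
    · exact hne i j h (by omega) hij
    · exact hne j i h (by omega) hij.symm
  have := Fintype.card_le_of_injective _ hinj
  simp only [Fintype.card_fin] at this
  omega

/-- After a record time of a real sequence with jumps at most `C` that later reaches its record
again, the next record time exceeds the current record by at most `C`. -/
theorem exists_next_record {s : ℕ → ℝ} {C : ℝ} (hstep : ∀ n, s (n + 1) ≤ s n + C) {n m : ℕ}
    (hn : ∀ j ≤ n, s j ≤ s n) (hnm : n < m) (hs : s n ≤ s m) :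
    ∃ n', n < n' ∧ n' ≤ m ∧ (∀ j ≤ n', s j ≤ s n') ∧ s n' ≤ s n + C ∧
      ∀ j, n < j → j < n' → s j < s n := by
  classical
  have hex : ∃ k, n < k ∧ s n ≤ s k := ⟨m, hnm, hs⟩
  obtain ⟨h1, h2⟩ := Nat.find_spec hex
  have hmin : ∀ j, n < j → j < Nat.find hex → s j < s n := fun j hj hj' => by
    by_contra hcon
    exact Nat.find_min hex hj' ⟨hj, not_lt.1 hcon⟩
  refine ⟨Nat.find hex, h1, Nat.find_min' hex ⟨hnm, hs⟩, ?_, ?_, hmin⟩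
  · intro j hj
    rcases le_or_gt j n with hjn | hjn
    · exact (hn j hjn).trans h2
    · rcases hj.lt_or_eq with hj | rfl
      · exact (hmin j hjn hj).le.trans h2
      · exact le_rfl
  -- Just before the next record s is at most the old record, so a single jump bounds the gain.
  · obtain ⟨k, hk⟩ : ∃ k, Nat.find hex = k + 1 := ⟨Nat.find hex - 1, by omega⟩
    rw [hk]
    refine (hstep k).trans ?_
    rcases eq_or_lt_of_le (show n ≤ k by omega) with h | h
    · rw [h]
    · linarith [hmin k h (by omega)]

/-- Between two record times one passes through consecutive record times. -/
theorem reflTransGen_of_records {β : Type*} {e : β → β → Prop} {lab : ℕ → β} {s : ℕ → ℝ} {C : ℝ}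
    (hstep : ∀ n, s (n + 1) ≤ s n + C)
    (he : ∀ n n', n < n' → (∀ j ≤ n', s j ≤ s n') → s n' ≤ s n + C → e (lab n) (lab n'))
    {m : ℕ} (hm : ∀ j ≤ m, s j ≤ s m) :
    ∀ d n, n + d = m → (∀ j ≤ n, s j ≤ s n) → Relation.ReflTransGen e (lab n) (lab m) := by
  intro d
  induction d using Nat.strong_induction_on with
  | _ d ih =>
    intro n hnd hn
    rcases Nat.eq_zero_or_pos d with rfl | hd
    · rw [← hnd]; exact Relation.ReflTransGen.refl
    · obtain ⟨n', h1, h2, h3, h4, -⟩ :=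
        exists_next_record hstep hn (show n < m by omega) (hm n (by omega))
      exact Relation.ReflTransGen.head (he n n' h1 h3 h4)
        (ih (m - n') (by omega) n' (by omega) h3)

/-! ### Backward good segments and contracting inverse branches -/

section Dynamics

variable {X : Type*} {f : X → X} {φ : X → ℝ}

/-- All final segments of the orbit segment `x, f x, …, f^[l - 1] x` have `φ`-average at
least `a`. -/
def BackwardGood (f : X → X) (φ : X → ℝ) (a : ℝ) (l : ℕ) (x : X) : Prop :=
  ∀ j k, j + k = l → k * a ≤ birkhoffSum f φ k (f^[j] x)

theorem BackwardGood.tail {a : ℝ} {l : ℕ} {x : X} (h : BackwardGood f φ a (l + 1) x) :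
    BackwardGood f φ a l (f x) := by
  intro j k hjk
  have := h (j + 1) k (by omega)
  rwa [Function.iterate_succ_apply] at this

theorem BackwardGood.le_birkhoffSum {a : ℝ} {l : ℕ} {x : X} (h : BackwardGood f φ a l x) :
    l * a ≤ birkhoffSum f φ l x := h 0 l (by simp)

/-- A final segment crossing the junction is a final segment of the first piece followed by all of
the second. -/
theorem BackwardGood.append {a : ℝ} {l₁ l₂ : ℕ} {x : X} (h₁ : BackwardGood f φ a l₁ x)
    (h₂ : BackwardGood f φ a l₂ (f^[l₁] x)) : BackwardGood f φ a (l₁ + l₂) x := by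
  intro j k hjk
  rcases le_or_gt l₁ j with hj | hj
  · have := h₂ (j - l₁) k (by omega)
    rwa [← Function.iterate_add_apply, Nat.sub_add_cancel hj] at this
  · obtain ⟨i, rfl⟩ : ∃ i, k = i + l₂ := ⟨k - l₂, by omega⟩
    have hi := h₁ j i (by omega)
    have h2 := h₂.le_birkhoffSum
    rw [birkhoffSum_add, ← Function.iterate_add_apply, show i + j = l₁ by omega]
    push_cast
    linarith

theorem birkhoffSum_sub_le {ε : ℝ} {x y : X} {l : ℕ}
    (h : ∀ i < l, |φ (f^[i] y) - φ (f^[i] x)| ≤ ε) :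
    |birkhoffSum f φ l y - birkhoffSum f φ l x| ≤ l * ε := by
  simp only [birkhoffSum, ← Finset.sum_sub_distrib]
  refine (Finset.abs_sum_le_sum_abs _ _).trans ?_
  refine (Finset.sum_le_card_nsmul _ _ ε fun i hi => h i (Finset.mem_range.1 hi)).trans ?_
  simp

variable [EMetricSpace X]

/-- A backward good orbit segment has an inverse branch along it, with contraction controlled by
the Birkhoff sum. -/
theorem exists_inverse_branch {K : Set X} (hK : MapsTo f K K) {α ε : ℝ} (hα : ε ≤ α)
    {ρ δ : ENNReal} (hρ : ρ < δ)
    (hbr : ∀ x ∈ K, ∃ g : X → X, g (f x) = x ∧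
      LipschitzOnWith (Real.toNNReal (Real.exp (-(φ x - ε)))) g (Metric.eball (f x) δ) ∧
      ∀ y ∈ Metric.eball (f x) δ, f (g y) = y) :
    ∀ l x, x ∈ K → BackwardGood f φ α l x → ∃ G : X → X, G (f^[l] x) = x ∧
      LipschitzOnWith (Real.toNNReal (Real.exp (-(birkhoffSum f φ l x - l * ε)))) G
        (Metric.closedEBall (f^[l] x) ρ) ∧
      ∀ w ∈ Metric.closedEBall (f^[l] x) ρ, f^[l] (G w) = w ∧
        ∀ i ≤ l, edist (f^[i] (G w)) (f^[i] x) ≤ ρ := by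
  intro l
  induction l with
  | zero =>
    intro x _ _
    refine ⟨id, rfl, by simpa using LipschitzWith.id.lipschitzOnWith, fun w hw => ⟨rfl, ?_⟩⟩
    intro i hi
    obtain rfl : i = 0 := by omega
    exact hw
  | succ l ih =>
    intro x hx hgood
    obtain ⟨G, hG, hGL, hGf⟩ := ih (f x) (hK hx) hgood.tail
    obtain ⟨g, hg, hgL, hgf⟩ := hbr x hx
    -- Tracking at index 0 puts `G w` in the domain of `g`; this is where `ρ < δ` enters.
    have hball : ∀ w ∈ Metric.closedEBall (f^[l] (f x)) ρ, G w ∈ Metric.eball (f x) δ :=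
      fun w hw => lt_of_le_of_lt ((hGf w hw).2 0 (Nat.zero_le _)) hρ
    have hL : LipschitzOnWith
        (Real.toNNReal (Real.exp (-(birkhoffSum f φ (l + 1) x - ((l + 1 : ℕ) : ℝ) * ε)))) (g ∘ G)
        (Metric.closedEBall (f^[l] (f x)) ρ) := by
      have := hgL.comp hGL hball
      rw [← Real.toNNReal_mul (Real.exp_pos _).le, ← Real.exp_add] at this
      convert this using 3
      rw [birkhoffSum_succ']
      push_cast
      ring
    have hfix : (g ∘ G) (f^[l] (f x)) = x := by simp [hG, hg]
    refine ⟨g ∘ G, hfix, hL, fun w hw => ?_⟩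
    rw [Function.iterate_succ_apply] at hw
    have hfG : f ((g ∘ G) w) = G w := hgf _ (hball w hw)
    refine ⟨?_, ?_⟩
    · rw [Function.iterate_succ_apply, hfG, (hGf w hw).1]
    · intro i hi
      cases i with
      | zero =>
        have h1 := hL hw (Metric.mem_closedEBall_self (x := f^[l] (f x)) (ε := ρ))
        rw [hfix] at h1
        refine h1.trans ((mul_le_mul' ?_ (Metric.mem_closedEBall.1 hw)).trans (one_mul ρ).le)
        -- Goodness at a rate `α ≥ ε` makes the exponent nonpositive, so the extended branch does
        -- not expand and its new point stays `ρ`-close to `x`.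
        have h2 := hgood.le_birkhoffSum
        have h3 : ((l + 1 : ℕ) : ℝ) * ε ≤ ((l + 1 : ℕ) : ℝ) * α := by gcongr
        have h4 : Real.toNNReal
            (Real.exp (-(birkhoffSum f φ (l + 1) x - ((l + 1 : ℕ) : ℝ) * ε))) ≤ 1 := by
          rw [Real.toNNReal_le_one, Real.exp_le_one_iff]
          linarith
        exact_mod_cast h4
      | succ i =>
        rw [Function.iterate_succ_apply, Function.iterate_succ_apply, hfG]
        exact (hGf w hw).2 i (by omega)

/-- A contracting inverse branch of `f^[τ]` from the `ρ`-ball at `b` to the `κ ρ`-ball at `a`, all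
of whose orbit segments stay in `V`, are backward good at rate `a₁`, have `φ`-sum at most
`τ a₂ + E`, and start at points satisfying `Q`. -/
def IsBranch (f : X → X) (φ : X → ℝ) (V : Set X) (a₁ a₂ : ℝ) (κ : NNReal) (ρ : ENNReal)
    (Q : X → Prop) (E : ℝ) (a b : X) (τ : ℕ) : Prop :=
  ∃ G : X → X, LipschitzOnWith κ G (Metric.closedEBall b ρ) ∧
    ∀ w ∈ Metric.closedEBall b ρ, G w ∈ Metric.closedEBall a (κ * ρ) ∧ f^[τ] (G w) = w ∧
      (∀ i < τ, f^[i] (G w) ∈ V) ∧ BackwardGood f φ a₁ τ (G w) ∧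
      birkhoffSum f φ τ (G w) ≤ τ * a₂ + E ∧ Q (G w)

/-- The second branch lands in the `κ ρ`-ball at `a'`, which lies in the domain of the first because
the jump from `b` to `a'` is small. The excesses add up, and `Q` survives because the composed orbit
starts with the first piece. -/
theorem IsBranch.comp {V : Set X} {a₁ a₂ : ℝ} {κ : NNReal} (hκ : κ ≤ 1) {ρ : ENNReal}
    {Q Q' : X → Prop} {E E' : ℝ} {a b a' b' : X} {τ τ' : ℕ}
    (h : IsBranch f φ V a₁ a₂ κ ρ Q E a b τ) (h' : IsBranch f φ V a₁ a₂ κ ρ Q' E' a' b' τ')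
    (hab : edist a' b + κ * ρ ≤ ρ) :
    IsBranch f φ V a₁ a₂ κ ρ Q (E + E') a b' (τ + τ') := by
  obtain ⟨G, hGL, hG⟩ := h
  obtain ⟨G', hGL', hG'⟩ := h'
  have hmaps : MapsTo G' (Metric.closedEBall b' ρ) (Metric.closedEBall b ρ) := by
    intro w hw
    rw [Metric.mem_closedEBall]
    calc edist (G' w) b ≤ edist (G' w) a' + edist a' b := edist_triangle _ _ _
      _ ≤ κ * ρ + edist a' b := by gcongr; exact (hG' w hw).1
      _ ≤ ρ := by rwa [add_comm]
  refine ⟨G ∘ G', ?_, fun w hw => ?_⟩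
  · exact (hGL.comp hGL' hmaps).weaken (mul_le_of_le_one_right' hκ)
  · obtain ⟨h1, h2, h3, h4, h5, h6⟩ := hG _ (hmaps hw)
    obtain ⟨h1', h2', h3', h4', h5', -⟩ := hG' w hw
    have hadd : ∀ i, f^[τ + i] ((G ∘ G') w) = f^[i] (G' w) := fun i => by
      rw [add_comm, Function.iterate_add_apply]
      exact congrArg _ h2
    refine ⟨h1, ?_, ?_, ?_, ?_, h6⟩
    · rw [hadd, h2']
    · intro i hi
      rcases lt_or_ge i τ with hi' | hi'
      · exact h3 i hi'
      · obtain ⟨j, rfl⟩ := Nat.exists_eq_add_of_le hi'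
        rw [hadd]
        exact h3' j (by omega)
    · refine h4.append ?_
      have := hadd 0
      simp only [add_zero, Function.iterate_zero, id_eq] at this
      rw [Function.comp_apply] at this
      rwa [this]
    · have := hadd 0
      simp only [add_zero, Function.iterate_zero, id_eq] at this
      rw [birkhoffSum_add, this]
      push_cast
      simp only [Function.comp_apply]
      linarith

/-- A branch whose ends are close has a periodic point. -/
theorem IsBranch.exists_periodic [CompleteSpace X] {V : Set X} {a₁ a₂ : ℝ} {κ : NNReal}
    (hκ : κ < 1) {ρ : ENNReal} (hρ : ρ ≠ ⊤) {Q : X → Prop} {E : ℝ} {a b : X} {τ : ℕ}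
    (h : IsBranch f φ V a₁ a₂ κ ρ Q E a b τ) (hab : edist a b + κ * ρ ≤ ρ) :
    ∃ p, f^[τ] p = p ∧ (∀ i < τ, f^[i] p ∈ V) ∧ BackwardGood f φ a₁ τ p ∧
      birkhoffSum f φ τ p ≤ τ * a₂ + E ∧ Q p := by
  obtain ⟨G, hGL, hG⟩ := h
  have hmaps : MapsTo G (Metric.closedEBall b ρ) (Metric.closedEBall b ρ) := by
    intro w hw
    rw [Metric.mem_closedEBall]
    calc edist (G w) b ≤ edist (G w) a + edist a b := edist_triangle _ _ _
      _ ≤ κ * ρ + edist a b := by gcongr; exact (hG w hw).1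
      _ ≤ ρ := by rwa [add_comm]
  have hb : b ∈ Metric.closedEBall b ρ := Metric.mem_closedEBall_self
  obtain ⟨p, hp, hfix, -⟩ := ContractingWith.exists_fixedPoint'
    (Metric.isClosed_closedEBall).isComplete hmaps
    ⟨hκ, (hGL.mapsToRestrict hmaps)⟩ hb
    (ne_top_of_le_ne_top hρ (by rw [edist_comm]; exact hmaps hb))
  have := (hG p hp).2
  rw [hfix.eq] at this
  exact ⟨p, this⟩

end Dynamics

/-! ### Shadowing and uniform scales on a compact set -/

section Dynamics

variable {X : Type*} [EMetricSpace X] {f : X → X} {φ : X → ℝ}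

/-- The inverse branch stays `ρ`-close to the orbit of `x`, so φ changes by at most `ε` per step;
this turns the rate `α` into `α - ε` below and `α + ε` above. One step already contracts by `κ`,
hence `1 ≤ l`. -/
theorem isBranch_of_backwardGood {K V : Set X} (hK : MapsTo f K K) {α ε : ℝ} (hα : ε ≤ α)
    {ρ δ : ENNReal} (hρ : ρ < δ)
    (hbr : ∀ x ∈ K, ∃ g : X → X, g (f x) = x ∧
      LipschitzOnWith (Real.toNNReal (Real.exp (-(φ x - ε)))) g (Metric.eball (f x) δ) ∧
      ∀ y ∈ Metric.eball (f x) δ, f (g y) = y)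
    (hunif : ∀ x ∈ K, ∀ y, edist y x ≤ ρ → y ∈ V ∧ |φ y - φ x| ≤ ε)
    {x : X} (hx : x ∈ K) {l : ℕ} (hl : 1 ≤ l) (hgood : BackwardGood f φ α l x) {C : ℝ}
    (hC : birkhoffSum f φ l x ≤ l * α + C) {Q : X → Prop}
    (hQ : ∀ z, (∀ i ≤ l, edist (f^[i] z) (f^[i] x) ≤ ρ) → Q z) :
    IsBranch f φ V (α - ε) (α + ε) (Real.toNNReal (Real.exp (-(α - ε)))) ρ Q C
      x (f^[l] x) l := by
  obtain ⟨G, hfix, hGL, hG⟩ := exists_inverse_branch hK hα hρ hbr l x hx hgood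
  have hl' : (1 : ℝ) ≤ l := by exact_mod_cast hl
  have hGL' : LipschitzOnWith (Real.toNNReal (Real.exp (-(α - ε)))) G
      (Metric.closedEBall (f^[l] x) ρ) := by
    refine hGL.weaken (Real.toNNReal_le_toNNReal (Real.exp_le_exp.2 ?_))
    have := hgood.le_birkhoffSum
    nlinarith
  have horb : ∀ i, f^[i] x ∈ K := fun i => hK.iterate i hx
  refine ⟨G, hGL', fun w hw => ?_⟩
  obtain ⟨hw1, hw2⟩ := hG w hw
  have hsum : ∀ j k, j + k ≤ l →
      |birkhoffSum f φ k (f^[j] (G w)) - birkhoffSum f φ k (f^[j] x)| ≤ k * ε := by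
    intro j k hjk
    refine birkhoffSum_sub_le fun i hi => ?_
    rw [← Function.iterate_add_apply, ← Function.iterate_add_apply]
    exact (hunif _ (horb _) _ (hw2 _ (by omega))).2
  refine ⟨?_, hw1, fun i hi => (hunif _ (horb i) _ (hw2 i hi.le)).1, ?_, ?_, hQ _ hw2⟩
  · have := hGL' hw (Metric.mem_closedEBall_self (x := f^[l] x) (ε := ρ))
    rw [hfix] at this
    exact this.trans (by gcongr; exact hw)
  · intro j k hjk
    have h1 := abs_le.1 (hsum j k hjk.le)
    have h2 := hgood j k hjk
    linarith [h1.1]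
  · have h1 := abs_le.1 (hsum 0 l (by simp))
    simp only [Function.iterate_zero, id_eq] at h1
    linarith [h1.2]

theorem exists_uniform_nhds {K V : Set X} (hK : IsCompact K) (hφ : ∀ x ∈ K, ContinuousAt φ x)
    (hV : V ∈ 𝓝ˢ K) {ε : ℝ} (hε : 0 < ε) :
    ∃ δ : ENNReal, 0 < δ ∧ ∀ x ∈ K, ∀ y, edist y x ≤ δ → y ∈ V ∧ |φ y - φ x| ≤ ε := by
  refine hK.induction_on (p := fun s => ∃ δ : ENNReal, 0 < δ ∧ ∀ x ∈ s, ∀ y, edist y x ≤ δ →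
    y ∈ V ∧ |φ y - φ x| ≤ ε) ⟨1, by simp⟩ ?_ ?_ ?_
  · rintro s t hst ⟨δ, hδ, h⟩
    exact ⟨δ, hδ, fun x hx => h x (hst hx)⟩
  · rintro s t ⟨δ, hδ, h⟩ ⟨δ', hδ', h'⟩
    refine ⟨min δ δ', lt_min hδ hδ', ?_⟩
    rintro x (hx | hx) y hy
    · exact h x hx y (hy.trans (min_le_left _ _))
    · exact h' x hx y (hy.trans (min_le_right _ _))
  · intro x₀ hx₀
    have hV₀ : ∀ᶠ y in 𝓝 x₀, y ∈ V := mem_nhdsSet_iff_forall.1 hV x₀ hx₀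
    have h1 : ∀ᶠ y in 𝓝 x₀, y ∈ V ∧ dist (φ y) (φ x₀) < ε / 2 :=
      hV₀.and ((hφ x₀ hx₀).eventually (Metric.ball_mem_nhds _ (half_pos hε)))
    obtain ⟨r, hr, hsub⟩ := EMetric.mem_nhds_iff.1 h1
    -- A finite radius is needed for adding a weak and a strict inequality in `ENNReal`.
    set r' := min r 1 with hr'
    have hr'0 : 0 < r' := lt_min hr one_pos
    have hr't : r' ≠ ⊤ := ne_top_of_le_ne_top ENNReal.one_ne_top (min_le_right _ _)
    refine ⟨Metric.eball x₀ (r' / 2), mem_nhdsWithin_of_mem_nhds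
      (Metric.eball_mem_nhds _ (ENNReal.half_pos hr'0.ne')), r' / 2, ENNReal.half_pos hr'0.ne', ?_⟩
    intro x hx y hy
    have hxr : x ∈ Metric.eball x₀ r :=
      (lt_of_lt_of_le hx ENNReal.half_le_self).trans_le (min_le_left _ _)
    have hyr : y ∈ Metric.eball x₀ r := by
      rw [Metric.mem_eball]
      calc edist y x₀ ≤ edist y x + edist x x₀ := edist_triangle _ _ _
        _ < r' / 2 + r' / 2 := ENNReal.add_lt_add_of_le_of_lt
            (ne_top_of_le_ne_top hr't (hy.trans ENNReal.half_le_self)) hy hx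
        _ = r' := ENNReal.add_halves _
        _ ≤ r := min_le_left _ _
    have h2 := (hsub hxr).2
    have h3 := hsub hyr
    refine ⟨h3.1, ?_⟩
    have h4 := h3.2
    rw [Real.dist_eq, abs_lt] at h2 h4
    rw [abs_le]
    constructor <;> linarith [h2.1, h2.2, h4.1, h4.2]

/-- A label is the centre of a ball of radius `η / 2` containing the point; `none` is a dummy value
off `K`. -/
theorem exists_finite_labels {K : Set X} (hK : IsCompact K) {η : ENNReal} (hη : 0 < η) :
    ∃ (t : Finset X) (lab : X → Option t),
      ∀ x ∈ K, ∀ y ∈ K, lab x = lab y → edist x y ≤ η := by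
  classical
  obtain ⟨t, -, ht⟩ := hK.elim_nhds_subcover (fun x => Metric.eball x (η / 2))
    (fun x _ => Metric.eball_mem_nhds _ (ENNReal.half_pos hη.ne'))
  have hex : ∀ x ∈ K, ∃ z ∈ t, edist x z < η / 2 := fun x hx => by
    simpa using ht hx
  refine ⟨t, fun x => if hx : x ∈ K then
    some ⟨(hex x hx).choose, (hex x hx).choose_spec.1⟩ else none, ?_⟩
  · intro x hx y hy hxy
    simp only [hx, hy, dif_pos, Option.some.injEq, Subtype.mk.injEq] at hxy
    calc edist x y ≤ edist x (hex x hx).choose + edist y (hex x hx).choose :=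
          edist_triangle_right _ _ _
      _ ≤ η / 2 + η / 2 := by
          refine add_le_add (hex x hx).choose_spec.2.le ?_
          rw [hxy]
          exact (hex y hy).choose_spec.2.le
      _ = η := ENNReal.add_halves _

theorem continuousAt_birkhoffSum {Y : Type*} [TopologicalSpace Y] {f : Y → Y} {φ : Y → ℝ}
    (hf : Continuous f) {K : Set Y}
    (hK : MapsTo f K K) (hφ : ∀ x ∈ K, ContinuousAt φ x) {x : Y} (hx : x ∈ K) (k : ℕ) :
    ContinuousAt (birkhoffSum f φ k) x := by
  unfold birkhoffSum
  refine tendsto_finsetSum _ fun i _ => ?_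
  exact ContinuousAt.comp (g := φ) (f := f^[i]) (hφ _ (hK.iterate i hx))
    (hf.iterate i).continuousAt

/-- A branch can be continued along a path of labels whose edges are realized by branches, at the
cost of an excess `C` per edge. -/
theorem exists_branch_of_path {β : Type*} {lab : X → β} {V K : Set X} {a₁ a₂ C : ℝ} {κ : NNReal}
    (hκ : κ ≤ 1) {ρ : ENNReal}
    (hlab : ∀ x ∈ K, ∀ y ∈ K, lab x = lab y → edist x y + κ * ρ ≤ ρ)
    {w : ℕ → β} :
    ∀ n, (∀ i < n, ∃ a ∈ K, ∃ b ∈ K, lab a = w i ∧ lab b = w (i + 1) ∧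
      ∃ τ, IsBranch f φ V a₁ a₂ κ ρ (fun _ => True) C a b τ) →
    ∀ {a b : X} {τ : ℕ} {Q : X → Prop} {E : ℝ}, b ∈ K →
      IsBranch f φ V a₁ a₂ κ ρ Q E a b τ → lab b = w 0 →
      ∃ b' ∈ K, ∃ τ' ≥ τ, lab b' = w n ∧
        IsBranch f φ V a₁ a₂ κ ρ Q (E + n * C) a b' τ' := by
  intro n
  induction n with
  | zero =>
    intro _ a b τ Q E hb h hw
    exact ⟨b, hb, τ, le_rfl, hw, by simpa using h⟩
  | succ n ih =>
    intro hpath a b τ Q E hb h hw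
    obtain ⟨b', hb', τ', hτ', hlb', h'⟩ := ih (fun i hi => hpath i (by omega)) hb h hw
    obtain ⟨c, hc, d, hd, hlc, hld, τ'', h''⟩ := hpath n (by omega)
    refine ⟨d, hd, τ' + τ'', by omega, hld, ?_⟩
    have := h'.comp hκ h'' (hlab c hc b' hb' (hlc.trans hlb'.symm))
    convert this using 1
    push_cast
    ring

end Dynamics

/-! ### Closing up a chain of record segments -/

section Dynamics

theorem birkhoffSum_iterate_eq_sub {X : Type*} {f : X → X} {φ : X → ℝ} (n k : ℕ) (q : X) :
    birkhoffSum f φ k (f^[n] q) = birkhoffSum f φ (n + k) q - birkhoffSum f φ n q := by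
  rw [birkhoffSum_add]; ring

theorem birkhoffSum_mul_add {X : Type*} {f : X → X} {φ : X → ℝ} {q : X} {m : ℕ}
    (hq : f^[m] q = q) (j i : ℕ) :
    birkhoffSum f φ (j * m + i) q = j * birkhoffSum f φ m q + birkhoffSum f φ i q := by
  induction j with
  | zero => simp
  | succ j ih =>
    rw [show (j + 1) * m + i = m + (j * m + i) by ring, birkhoffSum_add, hq, ih]
    push_cast
    ring

/-- The orbit segment ending at a record time of `n ↦ S_n φ q - n α` is backward good. -/
theorem backwardGood_of_record {X : Type*} {f : X → X} {φ : X → ℝ} {α : ℝ} {q : X} {n l : ℕ}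
    (h : ∀ j ≤ n + l, birkhoffSum f φ j q - j * α ≤
      birkhoffSum f φ (n + l) q - (n + l : ℕ) * α) :
    BackwardGood f φ α l (f^[n] q) := by
  intro j k hjk
  have := h (n + j) (by omega)
  rw [← Function.iterate_add_apply, add_comm j n, birkhoffSum_iterate_eq_sub,
    show n + j + k = n + l by omega]
  rw [← hjk] at this ⊢
  push_cast at this
  linarith

variable {X : Type*} [EMetricSpace X] [CompactSpace X] {f : X → X} {φ : X → ℝ}

/-- If some point in the closure of a family of periodic orbits with averages at least `c` has
small averages at all times, there are periodic orbits near the family with intermediate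
averages that are backward good and follow a bad segment of length `T`. -/
theorem exists_periodic_of_bad_point (hf : Continuous f) {Lam : Set X} (hinv : MapsTo f Lam Lam)
    (hφ : ∀ x ∈ closure Lam, ContinuousAt φ x) {c : ℝ}
    (havg : ∀ x ∈ Lam, ∃ m, 0 < m ∧ f^[m] x = x ∧ m * c ≤ birkhoffSum f φ m x)
    (hbr : ∀ ε : ℝ, 0 < ε → ∃ δ : ENNReal, 0 < δ ∧ ∀ x ∈ closure Lam, ∃ g : X → X,
      g (f x) = x ∧
      LipschitzOnWith (Real.toNNReal (Real.exp (-(φ x - ε)))) g (Metric.eball (f x) δ) ∧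
      ∀ y ∈ Metric.eball (f x) δ, f (g y) = y)
    {a₀ γ' γ'' : ℝ} (hγ' : 0 < γ') (ha₀ : a₀ < γ') (hγ : γ' < γ'') (hγ'' : γ'' < c)
    {x₀ : X} (hx₀ : x₀ ∈ closure Lam)
    (hbad : ∀ k : ℕ, 1 ≤ k → birkhoffSum f φ k x₀ ≤ k * a₀)
    {V : Set X} (hV : V ∈ 𝓝ˢ (closure Lam)) (T : ℕ) :
    ∃ a₁ > γ', ∃ p, ∃ τ : ℕ, 1 ≤ τ ∧ f^[τ] p = p ∧ (∀ i < τ, f^[i] p ∈ V) ∧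
      BackwardGood f φ a₁ τ p ∧ birkhoffSum f φ τ p < τ * γ'' ∧
      ∃ j, ∀ k : ℕ, 1 ≤ k → k ≤ T → birkhoffSum f φ k (f^[j] p) < k * γ' := by
  set K := closure Lam with hKdef
  have hK : IsCompact K := isClosed_closure.isCompact
  have hfK : MapsTo f K K := hinv.closure hf
  obtain ⟨α, hα⟩ : ∃ α, α = (γ' + γ'') / 2 := ⟨_, rfl⟩
  -- The first bound keeps `α ± ε` strictly between `γ'` and `γ''`. The second keeps `k a₀ + ε + k
  -- ε` below `k γ'`, which covers both the choice of `q` and the shadowing of its orbit.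
  obtain ⟨ε, hε, hε1, hε2⟩ : ∃ ε : ℝ, 0 < ε ∧ ε ≤ (γ'' - γ') / 4 ∧ ε ≤ (γ' - a₀) / 4 :=
    ⟨min ((γ'' - γ') / 4) ((γ' - a₀) / 4), lt_min (by linarith) (by linarith),
      min_le_left _ _, min_le_right _ _⟩
  have hεα : ε ≤ α := by linarith
  set κ := Real.toNNReal (Real.exp (-(α - ε))) with hκdef
  have hκ : κ < 1 := by
    rw [hκdef, Real.toNNReal_lt_one, Real.exp_lt_one_iff]
    linarith
  obtain ⟨δ₁, hδ₁, hbrδ⟩ := hbr ε hε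
  obtain ⟨δ₂, hδ₂, hunif⟩ := exists_uniform_nhds hK hφ hV hε
  obtain ⟨ρ, hρ0, hρt, hρ1, hρ2⟩ : ∃ ρ : ENNReal, 0 < ρ ∧ ρ ≠ ⊤ ∧ ρ < δ₁ ∧ ρ ≤ δ₂ := by
    have h1 : min δ₁ 1 ≠ ⊤ := ne_top_of_le_ne_top ENNReal.one_ne_top (min_le_right _ _)
    have h0 : min δ₁ 1 ≠ 0 := (lt_min hδ₁ one_pos).ne'
    have h2 := ENNReal.half_lt_self h0 h1
    exact ⟨min (min δ₁ 1 / 2) δ₂, lt_min (ENNReal.half_pos h0) hδ₂,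
      ne_top_of_le_ne_top h1 ((min_le_left _ _).trans h2.le),
      ((min_le_left _ _).trans_lt h2).trans_le (min_le_left _ _), min_le_right _ _⟩
  replace hunif : ∀ x ∈ K, ∀ y, edist y x ≤ ρ → y ∈ V ∧ |φ y - φ x| ≤ ε :=
    fun x hx y hy => hunif x hx y (hy.trans hρ2)
  have hκρ : (κ : ENNReal) * ρ < ρ := by
    have : (κ : ENNReal) * ρ < 1 * ρ := by
      rw [ENNReal.mul_lt_mul_iff_left hρ0.ne' hρt]
      exact_mod_cast hκ
    rwa [one_mul] at this
  obtain ⟨t, lab, hlab⟩ := exists_finite_labels hK (tsub_pos_of_lt hκρ)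
  replace hlab : ∀ x ∈ K, ∀ y ∈ K, lab x = lab y → edist x y + κ * ρ ≤ ρ := by
    intro x hx y hy hxy
    calc edist x y + κ * ρ ≤ (ρ - κ * ρ) + κ * ρ := by gcongr; exact hlab x hx y hy hxy
      _ = ρ := tsub_add_cancel_of_le hκρ.le
  obtain ⟨C, hC⟩ := hK.exists_bound_of_continuousOn
    (fun x hx => (hφ x hx).continuousWithinAt : ContinuousOn φ K)
  have hC0 : 0 ≤ C := (norm_nonneg _).trans (hC x₀ hx₀)
  set N₀ := Fintype.card (Option t) with hN₀
  have hgap : 0 < γ'' - (α + ε) := by linarith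
  -- `N₀ + 1` counts the long edge and at most `N₀` edges closing it; `N` is fixed before `q`, as
  -- `N₀` and `C` depend only on `K` and the scales.
  obtain ⟨N, hTN, hN⟩ : ∃ N : ℕ, T ≤ N ∧ (N₀ + 1) * C < N * (γ'' - (α + ε)) := by
    obtain ⟨N, hN⟩ := exists_nat_gt ((N₀ + 1) * C / (γ'' - (α + ε)))
    refine ⟨max T N, le_max_left _ _, ?_⟩
    rw [div_lt_iff₀ hgap] at hN
    refine hN.trans_le ?_
    gcongr
    exact le_max_right _ _
  -- a periodic point following the bad point for a long time
  obtain ⟨q, hqbad, hq⟩ : ∃ q, (∀ k ∈ Finset.range (N + 1),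
      birkhoffSum f φ k q < k * a₀ + ε) ∧ q ∈ Lam := by
    have h1 : ∀ᶠ y in 𝓝 x₀, ∀ k ∈ Finset.range (N + 1), birkhoffSum f φ k y < k * a₀ + ε := by
      rw [Filter.eventually_all_finset]
      intro k _
      refine (continuousAt_birkhoffSum hf hfK hφ hx₀ k).eventually (Iio_mem_nhds ?_)
      rcases Nat.eq_zero_or_pos k with rfl | hk
      · simpa using hε
      · linarith [hbad k hk]
    obtain ⟨q, h2, h3⟩ := mem_closure_iff_nhds.1 hx₀ _ h1
    exact ⟨q, h2, h3⟩
  obtain ⟨m, hm, hqm, hqc⟩ := havg q hq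
  have horb : ∀ i, f^[i] q ∈ K := fun i => subset_closure (hinv.iterate i hq)
  set s : ℕ → ℝ := fun n => birkhoffSum f φ n q - n * α with hs
  have hs0 : s 0 = 0 := by simp [hs]
  have hstep : ∀ n, s (n + 1) ≤ s n + C := by
    intro n
    have := (le_abs_self _).trans (hC _ (horb n))
    simp only [hs, birkhoffSum_succ]
    push_cast
    linarith
  have hsm : 0 < s m := by
    have hm' : (0 : ℝ) < m := by exact_mod_cast hm
    simp only [hs]
    nlinarith
  have hsper : ∀ j i, s (j * m + i) = j * s m + s i := by
    intro j i
    simp only [hs, birkhoffSum_mul_add hqm]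
    push_cast
    ring
  -- At time `m` the orbit is back at `q`, where averages are below `α` for `N` steps.
  have hsbad : ∀ k, 1 ≤ k → k ≤ N → s (m + k) < s m := by
    intro k hk hkN
    have h1 := hqbad k (Finset.mem_range.2 (by omega))
    have h2 := hsper 1 k
    have hk' : (1 : ℝ) ≤ k := by exact_mod_cast hk
    rw [one_mul] at h2
    rw [h2]
    simp only [hs]
    push_cast
    nlinarith
  -- the last record time up to `m`
  classical
  obtain ⟨n₀, hn₀m, hn₀, hlast⟩ : ∃ n₀ ≤ m, (∀ j ≤ m, s j ≤ s n₀) ∧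
      ∀ i, n₀ < i → i ≤ m → ¬ ∀ j ≤ m, s j ≤ s i := by
    obtain ⟨i, hi, hmax⟩ := Finset.exists_max_image (Finset.range (m + 1)) s ⟨0, by simp⟩
    have hP : ∀ j ≤ m, s j ≤ s i := fun j hj => hmax j (by simpa [Nat.lt_succ_iff] using hj)
    have him : i ≤ m := by simpa [Nat.lt_succ_iff] using hi
    exact ⟨Nat.findGreatest (fun i => ∀ j ≤ m, s j ≤ s i) m, Nat.findGreatest_le _,
      Nat.findGreatest_spec (P := fun i => ∀ j ≤ m, s j ≤ s i) him hP,
      fun i h1 h2 => Nat.findGreatest_is_greatest h1 h2⟩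
  have hn₀rec : ∀ j ≤ n₀, s j ≤ s n₀ := fun j hj => hn₀ j (hj.trans hn₀m)
  -- Each period repeats the graph of `s`, raised by `s m > 0`, so translates of the maximum `n₀`
  -- are again records.
  have hrec : ∀ j i, i ≤ j * m + n₀ → s i ≤ s (j * m + n₀) := by
    intro j i hi
    rw [hsper]
    rcases le_or_gt (j * m) i with hji | hji
    · obtain ⟨k, rfl⟩ := Nat.exists_eq_add_of_le hji
      rw [hsper]
      linarith [hn₀rec k (by omega)]
    · have h1 : i / m < j := (Nat.div_lt_iff_lt_mul hm).2 hji
      have h2 := hsper (i / m) (i % m)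
      rw [mul_comm, Nat.div_add_mod] at h2
      rw [h2]
      have h3 := hn₀ (i % m) (Nat.mod_lt _ hm).le
      have h4 : ((i / m : ℕ) : ℝ) * s m ≤ j * s m := by gcongr
      linarith
  set J := m + N + 1 with hJ
  have hJm : m + N + 1 ≤ J * m := Nat.le_mul_of_pos_right _ hm
  obtain ⟨n', hn1, hn2, hn3, hn4, -⟩ := exists_next_record hstep hn₀rec
    (show n₀ < J * m + n₀ by omega) (hrec J n₀ (by omega))
  -- A next record up to `m` would contradict the choice of `n₀` as the last maximum; one in the bad
  -- stretch would lie below `s m`.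
  have hn' : m + N < n' := by
    by_contra hcon
    rcases le_or_gt n' m with h | h
    · exact hlast n' hn1 h fun j hj => (hn₀ j hj).trans (hn3 n₀ hn1.le)
    · have h1 := hsbad (n' - m) (by omega) (by omega)
      rw [Nat.add_sub_cancel' h.le] at h1
      linarith [hn₀ m le_rfl, hn3 n₀ hn1.le]
  have hedge : ∀ (Q : X → Prop) (n l : ℕ), 1 ≤ l → (∀ j ≤ n + l, s j ≤ s (n + l)) →
      s (n + l) ≤ s n + C →
      (∀ z, (∀ i ≤ l, edist (f^[i] z) (f^[i] (f^[n] q)) ≤ ρ) → Q z) →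
      IsBranch f φ V (α - ε) (α + ε) κ ρ Q C (f^[n] q) (f^[n + l] q) l := by
    intro Q n l hl hr hsC hQ
    have := isBranch_of_backwardGood hfK hεα hρ1 hbrδ hunif (horb n) hl
      (backwardGood_of_record hr) (C := C) (Q := Q) ?_ hQ
    · rwa [← Function.iterate_add_apply, add_comm l n] at this
    · rw [birkhoffSum_iterate_eq_sub]
      simp only [hs] at hsC
      push_cast at hsC
      linarith
  -- The records of `q` only show that the starting label can be reached again; the path used below
  -- is a shortest one.
  have hpath := reflTransGen_of_records
    (e := fun u v => ∃ a ∈ K, ∃ b ∈ K, lab a = u ∧ lab b = v ∧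
      ∃ τ, IsBranch f φ V (α - ε) (α + ε) κ ρ (fun _ => True) C a b τ)
    (lab := fun n => lab (f^[n] q)) hstep ?_ (hrec J) (J * m + n₀ - n') n' (by omega) hn3
  swap
  · intro n k hnk hk hkC
    obtain ⟨l, rfl⟩ := Nat.exists_eq_add_of_lt hnk
    exact ⟨_, horb n, _, horb _, rfl, rfl, _,
      hedge _ n (l + 1) (by omega) hk hkC fun _ _ => trivial⟩
  obtain ⟨r, hr, w, hw0, hwr, hw⟩ := exists_short_path hpath
  obtain ⟨l, rfl⟩ := Nat.exists_eq_add_of_lt hn1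
  -- The long edge starts at time `n₀`, so the bad stretch begins `m - n₀` steps into it; `Q` passes
  -- this information on to the shadowing orbit.
  have hlong := hedge (fun z => ∀ k : ℕ, 1 ≤ k → k ≤ N →
    birkhoffSum f φ k (f^[m - n₀] z) < k * γ') n₀ (l + 1) (by omega) hn3 hn4 ?_
  swap
  · intro z hz k hk hkN
    have h1 : |birkhoffSum f φ k (f^[m - n₀] z) - birkhoffSum f φ k q| ≤ k * ε := by
      refine birkhoffSum_sub_le fun i hi => ?_
      have h2 := (hunif _ ?_ _ (hz (i + (m - n₀)) (by omega))).2
      · rwa [← Function.iterate_add_apply f _ n₀, add_assoc, Nat.sub_add_cancel hn₀m,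
          Function.iterate_add_apply, Function.iterate_add_apply f i m, hqm] at h2
      · rw [← Function.iterate_add_apply]
        exact horb _
    have h3 := hqbad k (Finset.mem_range.2 (by omega))
    have hk' : (1 : ℝ) ≤ k := by exact_mod_cast hk
    have h4 := (abs_le.1 h1).2
    nlinarith
  obtain ⟨b', hb', τ, hτ, hlb', hbranch⟩ :=
    exists_branch_of_path hκ.le hlab r hw (horb _) hlong hw0.symm
  -- The path ends at the label of the point at time `J * m + n₀`, which is the point at time `n₀`.
  have hclose : lab (f^[n₀] q) = lab b' := by
    rw [hlb', hwr, add_comm (J * m), Function.iterate_add_apply]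
    congr 2
    exact ((Function.IsPeriodicPt.const_mul (show Function.IsPeriodicPt f m q from hqm) J)).symm
  obtain ⟨p, hp1, hp2, hp3, hp4, hp5⟩ := hbranch.exists_periodic hκ hρt
    (hlab _ (horb _) _ hb' hclose)
  refine ⟨α - ε, by linarith, p, τ, by omega, hp1, hp2, hp3, hp4.trans_lt ?_, m - n₀,
    fun k hk hkT => hp5 k hk (hkT.trans hTN)⟩
  have h1 : (r : ℝ) * C ≤ N₀ * C := by gcongr
  have h2 : (N : ℝ) ≤ τ := by exact_mod_cast (by omega : N ≤ τ)
  have h3 : (N : ℝ) * (γ'' - (α + ε)) ≤ τ * (γ'' - (α + ε)) := by gcongr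
  linarith

end Dynamics

/-! ### Periodic averages, minimal periods and uniform growth -/

section Dynamics

variable {X : Type*} {f : X → X} {φ : X → ℝ}

theorem birkhoffSum_iterate_of_periodic {p : X} {m : ℕ} (hp : f^[m] p = p) (j : ℕ) :
    birkhoffSum f φ m (f^[j] p) = birkhoffSum f φ m p := by
  rw [birkhoffSum_iterate_eq_sub, add_comm, birkhoffSum_add, hp]
  ring

theorem sum_Icc_iterate_sub {p : X} {m k : ℕ} (hk : k ≤ m) :
    ∑ i ∈ Finset.Icc 1 k, φ (f^[m - i] p) = birkhoffSum f φ k (f^[m - k] p) := by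
  unfold birkhoffSum
  refine Finset.sum_nbij' (fun i => k - i) (fun i => k - i) ?_ ?_ ?_ ?_ ?_
  · intro i hi
    simp only [Finset.mem_Icc, Finset.mem_range] at hi ⊢
    omega
  · intro i hi
    simp only [Finset.mem_Icc, Finset.mem_range] at hi ⊢
    omega
  · intro i hi
    simp only [Finset.mem_Icc] at hi
    omega
  · intro i hi
    simp only [Finset.mem_range] at hi
    omega
  · intro i hi
    simp only [Finset.mem_Icc] at hi
    rw [← Function.iterate_add_apply, show k - i + (m - k) = m - i by omega]

/-- Passing to the minimal period. -/
theorem minimalPeriod_estimates {V : Set X} {a₁ γ' γ'' : ℝ} (ha₁ : γ' < a₁) {p : X} {τ T : ℕ}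
    (hτ : 1 ≤ τ) (hp : f^[τ] p = p) (hV : ∀ i < τ, f^[i] p ∈ V)
    (hgood : BackwardGood f φ a₁ τ p) (hsum : birkhoffSum f φ τ p < τ * γ'') {j : ℕ}
    (hbad : ∀ k : ℕ, 1 ≤ k → k ≤ T → birkhoffSum f φ k (f^[j] p) < k * γ') :
    p ∈ Function.periodicPts f ∧ T ≤ Function.minimalPeriod f p ∧ (∀ i, f^[i] p ∈ V) ∧
      (1 / (Function.minimalPeriod f p : ℝ)) *
        ∑ i ∈ Finset.range (Function.minimalPeriod f p), φ (f^[i] p) < γ'' ∧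
      ∀ k : ℕ, 1 ≤ k → k ≤ Function.minimalPeriod f p → γ' < (1 / (k : ℝ)) *
        ∑ i ∈ Finset.Icc 1 k, φ (f^[Function.minimalPeriod f p - i] p) := by
  have hper : Function.IsPeriodicPt f τ p := hp
  have hmem : p ∈ Function.periodicPts f := Function.mk_mem_periodicPts hτ hper
  have hm0 := Function.minimalPeriod_pos_of_mem_periodicPts hmem
  have hmp : f^[Function.minimalPeriod f p] p = p := Function.iterate_minimalPeriod
  obtain ⟨d, hd⟩ := hper.minimalPeriod_dvd
  generalize Function.minimalPeriod f p = m at *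
  have hd0 : 1 ≤ d := by
    rcases Nat.eq_zero_or_pos d with rfl | h
    · omega
    · exact h
  obtain ⟨d, rfl⟩ := Nat.exists_eq_add_of_le' hd0
  have hmR : (0 : ℝ) < m := by exact_mod_cast hm0
  have hback : ∀ k : ℕ, 1 ≤ k → k ≤ m → k * γ' < birkhoffSum f φ k (f^[m - k] p) := by
    intro k hk hkm
    have h1 := hgood (τ - k) k (by
      have : m ≤ τ := by rw [hd]; exact Nat.le_mul_of_pos_right _ (by omega)
      omega)
    -- Final segments of length at most `m` are the same whether the orbit is run for `τ` or for `m`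
    -- steps.
    have h2 : τ - k = m - k + d * m := by
      rw [hd, mul_add, mul_one, mul_comm m d]
      omega
    have h3 : f^[d * m] p = p :=
      Function.IsPeriodicPt.const_mul (show Function.IsPeriodicPt f m p from hmp) d
    rw [h2, Function.iterate_add_apply, h3] at h1
    have hk' : (0 : ℝ) < k := by exact_mod_cast hk
    nlinarith
  refine ⟨hmem, ?_, ?_, ?_, ?_⟩
  -- If `m < T`, the bad stretch includes a full minimal period, whose sum does not depend on the
  -- starting point and exceeds `m γ'`.
  · by_contra hcon
    have h1 := hback m hm0 le_rfl
    have h2 := hbad m hm0 (by omega)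
    rw [birkhoffSum_iterate_of_periodic hmp] at h1 h2
    linarith
  · intro i
    rw [← hper.iterate_mod_apply]
    exact hV _ (Nat.mod_lt _ hτ)
  · have h1 := birkhoffSum_mul_add (φ := φ) hmp (d + 1) 0
    rw [add_zero, mul_comm, ← hd, birkhoffSum_zero, add_zero] at h1
    rw [h1, hd] at hsum
    push_cast at hsum
    have h2 : birkhoffSum f φ m p < m * γ'' := by
      have h3 : (0 : ℝ) < d + 1 := by positivity
      nlinarith
    change 1 / (m : ℝ) * birkhoffSum f φ m p < γ''
    rw [one_div, inv_mul_lt_iff₀ hmR]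
    exact h2
  · intro k hk hkm
    have hk' : (0 : ℝ) < k := by exact_mod_cast hk
    rw [sum_Icc_iterate_sub hkm, one_div, lt_inv_mul_iff₀ hk']
    exact hback k hk hkm

/-- Along a periodic orbit the Birkhoff averages converge to the average over the orbit. -/
theorem tendsto_birkhoff_of_periodic {x : X} {m : ℕ} (hm : 0 < m) (hx : f^[m] x = x) :
    Tendsto (fun k : ℕ => (1 / (k : ℝ)) * ∑ i ∈ Finset.range k, φ (f^[i] x)) atTop
      (𝓝 (birkhoffSum f φ m x / m)) := by
  set A := birkhoffSum f φ m x / m with hA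
  have hmR : (0 : ℝ) < m := by exact_mod_cast hm
  have hAm : birkhoffSum f φ m x = m * A := by rw [hA]; field_simp
  set u : ℕ → ℝ := fun k => birkhoffSum f φ k x - k * A with hu
  -- The deviation from linear growth is `m`-periodic, hence bounded.
  have hbound : ∀ k, |u k| ≤ ∑ i ∈ Finset.range m, |u i| := by
    intro k
    have h1 : u k = u (k % m) := by
      have h2 := birkhoffSum_mul_add (φ := φ) hx (k / m) (k % m)
      have h3 : k / m * m + k % m = k := by rw [mul_comm]; exact Nat.div_add_mod k m
      rw [h3] at h2
      have h4 : (k : ℝ) = (k / m : ℕ) * m + (k % m : ℕ) := by exact_mod_cast h3.symm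
      simp only [hu]
      rw [h2, hAm]
      linear_combination (-A) * h4
    rw [h1]
    exact Finset.single_le_sum (f := fun i => |u i|) (fun _ _ => abs_nonneg _)
      (Finset.mem_range.2 (Nat.mod_lt _ hm))
  have h0 : Tendsto (fun k : ℕ => u k / k) atTop (𝓝 0) := by
    refine squeeze_zero_norm (fun k => ?_)
      (tendsto_const_div_atTop_nhds_zero_nat (∑ i ∈ Finset.range m, |u i|))
    rw [norm_div, Real.norm_natCast, Real.norm_eq_abs]
    gcongr
    exact hbound k
  have h1 := h0.const_add A
  rw [add_zero] at h1
  refine h1.congr' ?_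
  filter_upwards [eventually_gt_atTop 0] with k hk
  have hkR : (0 : ℝ) < k := by exact_mod_cast hk
  change A + (birkhoffSum f φ k x - k * A) / k = 1 / (k : ℝ) * birkhoffSum f φ k x
  field_simp
  ring

theorem mul_le_birkhoffSum_of_le_limsup {x : X} {m : ℕ} (hm : 0 < m) (hx : f^[m] x = x) {c : ℝ}
    (h : c ≤ limsup (fun k : ℕ => (1 / (k : ℝ)) * ∑ i ∈ Finset.range k, φ (f^[i] x)) atTop) :
    m * c ≤ birkhoffSum f φ m x := by
  rw [(tendsto_birkhoff_of_periodic hm hx).limsup_eq,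
    le_div_iff₀ (by exact_mod_cast hm : (0 : ℝ) < m)] at h
  linarith

/-- If every point of a compact forward invariant set has at some time an average above `a₀`, the
Birkhoff sums grow uniformly at rate `a₀`. -/
theorem exists_uniform_growth [TopologicalSpace X] (hf : Continuous f) {K : Set X}
    (hK : IsCompact K) (hfK : MapsTo f K K) (hφ : ∀ x ∈ K, ContinuousAt φ x) {a₀ : ℝ}
    (ha₀ : 0 < a₀) (h : ∀ x ∈ K, ∃ k : ℕ, 1 ≤ k ∧ k * a₀ < birkhoffSum f φ k x) :
    ∃ D : ℝ, ∀ x ∈ K, ∀ k : ℕ, k * a₀ - D ≤ birkhoffSum f φ k x := by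
  obtain ⟨N, hN⟩ : ∃ N : ℕ, ∀ x ∈ K, ∃ k : ℕ, 1 ≤ k ∧ k ≤ N ∧ k * a₀ < birkhoffSum f φ k x := by
    refine hK.induction_on (p := fun s => ∃ N : ℕ, ∀ x ∈ s, ∃ k : ℕ, 1 ≤ k ∧ k ≤ N ∧
      k * a₀ < birkhoffSum f φ k x) ⟨0, by simp⟩ ?_ ?_ ?_
    · rintro s t hst ⟨N, hN⟩
      exact ⟨N, fun x hx => hN x (hst hx)⟩
    · rintro s t ⟨N, hN⟩ ⟨N', hN'⟩
      refine ⟨max N N', ?_⟩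
      rintro x (hx | hx)
      · obtain ⟨k, h1, h2, h3⟩ := hN x hx
        exact ⟨k, h1, h2.trans (le_max_left _ _), h3⟩
      · obtain ⟨k, h1, h2, h3⟩ := hN' x hx
        exact ⟨k, h1, h2.trans (le_max_right _ _), h3⟩
    · intro x hx
      obtain ⟨k, hk, hlt⟩ := h x hx
      have h1 := (continuousAt_birkhoffSum hf hfK hφ hx k).eventually (Ioi_mem_nhds hlt)
      exact ⟨_, mem_nhdsWithin_of_mem_nhds h1, k, fun y hy => ⟨k, hk, le_rfl, hy⟩⟩
  obtain ⟨B, hB⟩ := hK.exists_bound_of_continuousOn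
    (fun x hx => (hφ x hx).continuousWithinAt : ContinuousOn φ K)
  -- Blocks of length at most `N` with average above `a₀` are split off; `D` pays for the last
  -- incomplete block.
  refine ⟨N * (|B| + a₀), fun x hx k => ?_⟩
  induction k using Nat.strong_induction_on generalizing x with
  | _ k ih =>
    rcases le_or_gt k N with hkN | hkN
    · have h1 : -(k * |B|) ≤ birkhoffSum f φ k x := by
        have : ∀ i ∈ Finset.range k, -|B| ≤ φ (f^[i] x) := fun i _ => by
          have := (abs_le.1 ((hB _ (hfK.iterate i hx)).trans (le_abs_self B))).1
          exact this
        have := Finset.card_nsmul_le_sum _ _ _ this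
        simpa [birkhoffSum] using this
      have h2 : (k : ℝ) * (|B| + a₀) ≤ N * (|B| + a₀) := by gcongr
      linarith
    · obtain ⟨l, hl1, hlN, hl⟩ := hN x hx
      obtain ⟨r, rfl⟩ := Nat.exists_eq_add_of_le (show l ≤ k by omega)
      have := ih r (by omega) (f^[l] x) (hfK.iterate l hx)
      rw [birkhoffSum_add]
      push_cast
      linarith

end Dynamics

/-! ### The co-norm and critical points -/

section Conorm

variable {E F : Type*} [NormedAddCommGroup E] [NormedSpace ℝ E] [NormedAddCommGroup F]
  [NormedSpace ℝ F]

theorem conorm_mul_le (T : E →L[ℝ] F) (v : E) : conorm T * ‖v‖ ≤ ‖T v‖ := by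
  rcases eq_or_ne v 0 with rfl | hv
  · simp
  have hv' : 0 < ‖v‖ := norm_pos_iff.2 hv
  have h1 : conorm T ≤ ‖T (‖v‖⁻¹ • v)‖ := by
    refine csInf_le ⟨0, ?_⟩ ⟨‖v‖⁻¹ • v, ?_, rfl⟩
    · rintro _ ⟨w, -, rfl⟩
      exact norm_nonneg _
    · simp [norm_smul, hv'.ne']
  rw [map_smul, norm_smul, norm_inv, norm_norm, le_inv_mul_iff₀ hv'] at h1
  linarith

theorem conorm_pos [FiniteDimensional ℝ E] [Nontrivial E] {T : E →L[ℝ] F}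
    (hT : Function.Injective T) : 0 < conorm T := by
  have : ProperSpace E := FiniteDimensional.proper ℝ E
  have hne : (Metric.sphere (0 : E) 1).Nonempty := NormedSpace.sphere_nonempty.2 zero_le_one
  obtain ⟨v, hv, hmin⟩ := ((isCompact_sphere (0 : E) 1).image
    (T.continuous.norm)).sInf_mem (hne.image _)
  unfold conorm
  rw [← hmin]
  refine norm_pos_iff.2 fun h0 => ?_
  have : v = 0 := hT (by simpa using h0)
  simp [this] at hv

theorem injective_of_conorm_pos {T : E →L[ℝ] F} (hT : 0 < conorm T) : Function.Injective T := by
  refine (injective_iff_map_eq_zero T).2 fun v hv => ?_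
  have := conorm_mul_le T v
  rw [hv, norm_zero] at this
  by_contra hne
  have : 0 < conorm T * ‖v‖ := mul_pos hT (norm_pos_iff.2 hne)
  linarith

/-- The co-norm as the infimum of `‖T v‖ / ‖v‖` over the image of a sphere under a linear
isomorphism. -/
theorem conorm_eq_sInf_ratio {G : Type*} [NormedAddCommGroup G] [NormedSpace ℝ G]
    (T : E →L[ℝ] F) (e : G ≃L[ℝ] E) :
    conorm T = sInf ((fun v : G => ‖T (e v)‖ / ‖e v‖) '' Metric.sphere (0 : G) 1) := by
  unfold conorm
  congr 1
  ext r
  constructor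
  · rintro ⟨v, hv, rfl⟩
    have hv1 : ‖v‖ = 1 := by simpa using hv
    have hv0 : v ≠ 0 := by rintro rfl; simp at hv1
    have hw0 : e.symm v ≠ 0 := by simpa using hv0
    have hw : 0 < ‖e.symm v‖ := norm_pos_iff.2 hw0
    refine ⟨‖e.symm v‖⁻¹ • e.symm v, by simp [norm_smul, hw.ne'], ?_⟩
    simp only [map_smul, e.apply_symm_apply, norm_smul, norm_inv, norm_norm, hv1]
    field_simp
  · rintro ⟨v, hv, rfl⟩
    have hv1 : ‖v‖ = 1 := by simpa using hv
    have hv0 : e v ≠ 0 := by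
      rw [Ne, map_eq_zero_iff _ e.injective]
      rintro rfl
      simp at hv1
    have hw : 0 < ‖e v‖ := norm_pos_iff.2 hv0
    refine ⟨‖e v‖⁻¹ • e v, by simp [norm_smul, hw.ne'], ?_⟩
    simp only [map_smul, norm_smul, norm_inv, norm_norm]
    field_simp

end Conorm

theorem not_isCriticalPoint_iff_injective {n : ℕ} {M : Type*} [TopologicalSpace M]
    [ChartedSpace (EuclideanSpace ℝ (Fin n)) M] {f : M → M} {x : M} :
    ¬ IsCriticalPoint n f x ↔ Function.Injective (mfderiv (𝓡 n) (𝓡 n) f x) := by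
  have key : ∀ A : EuclideanSpace ℝ (Fin n) →L[ℝ] EuclideanSpace ℝ (Fin n),
      Function.Injective A ↔ Function.Surjective A := fun A =>
    LinearMap.injective_iff_surjective (f := A.toLinearMap)
  rw [IsCriticalPoint, not_not]
  exact (key (mfderiv (𝓡 n) (𝓡 n) f x)).symm

theorem not_isCriticalPoint_iff_conorm_pos {n : ℕ} {M : Type*} [TopologicalSpace M]
    [ChartedSpace (EuclideanSpace ℝ (Fin n)) M]
    [RiemannianBundle (fun x : M => TangentSpace (𝓡 n) x)] (hn : 1 ≤ n) {f : M → M} {x : M} :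
    ¬ IsCriticalPoint n f x ↔ 0 < conorm (mfderiv (𝓡 n) (𝓡 n) f x) := by
  have : NeZero n := ⟨by omega⟩
  have : FiniteDimensional ℝ (TangentSpace (𝓡 n) x) :=
    inferInstanceAs (FiniteDimensional ℝ (EuclideanSpace ℝ (Fin n)))
  have : Nontrivial (TangentSpace (𝓡 n) x) :=
    inferInstanceAs (Nontrivial (EuclideanSpace ℝ (Fin n)))
  rw [not_isCriticalPoint_iff_injective]
  exact ⟨conorm_pos, injective_of_conorm_pos⟩

/-! ### Continuity of the co-norm and growth of derivatives -/

section Manifold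

variable {n : ℕ} {M : Type*} [TopologicalSpace M] [ChartedSpace (EuclideanSpace ℝ (Fin n)) M]
  [IsManifold (𝓡 n) ∞ M] [RiemannianBundle (fun x : M => TangentSpace (𝓡 n) x)]

theorem isContinuousRiemannianBundle
    [h : IsContMDiffRiemannianBundle (𝓡 n) ∞ (EuclideanSpace ℝ (Fin n))
      (fun x : M => TangentSpace (𝓡 n) x)] :
    IsContinuousRiemannianBundle (EuclideanSpace ℝ (Fin n))
      (fun x : M => TangentSpace (𝓡 n) x) := by
  obtain ⟨g, hg, hg'⟩ := h.exists_contMDiff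
  exact ⟨g, hg.continuous, hg'⟩

theorem continuous_norm_tangentBundle
    [IsContinuousRiemannianBundle (EuclideanSpace ℝ (Fin n))
      (fun x : M => TangentSpace (𝓡 n) x)] :
    Continuous (fun v : TangentBundle (𝓡 n) M => ‖v.2‖) := by
  have h : Continuous (fun v : TangentBundle (𝓡 n) M => inner ℝ v.2 v.2) :=
    Continuous.inner_bundle (F := EuclideanSpace ℝ (Fin n))
      (E := fun x : M => TangentSpace (𝓡 n) x) (b := fun v : TangentBundle (𝓡 n) M => v.1)
      (v := fun v => v.2) (w := fun v => v.2) continuous_id continuous_id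
  have h2 := h.sqrt
  refine h2.congr fun v => ?_
  rw [real_inner_self_eq_norm_sq, Real.sqrt_sq (norm_nonneg _)]

/-- In a local trivialization the co-norm becomes the infimum, over the fixed compact Euclidean
sphere, of a jointly continuous ratio of norms; such an infimum is continuous in the base point. -/
theorem continuous_conorm_mfderiv
    [IsContinuousRiemannianBundle (EuclideanSpace ℝ (Fin n))
      (fun x : M => TangentSpace (𝓡 n) x)] {f : M → M} (hf : ContMDiff (𝓡 n) (𝓡 n) 1 f) :
    Continuous (fun x => conorm (mfderiv (𝓡 n) (𝓡 n) f x)) := by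
  rw [continuous_iff_continuousAt]
  intro x₀
  set e := trivializationAt (EuclideanSpace ℝ (Fin n)) (fun x : M => TangentSpace (𝓡 n) x) x₀
    with he
  have hx₀ : x₀ ∈ e.baseSet := FiberBundle.mem_baseSet_trivializationAt' x₀
  have : IsManifold (𝓡 n) 1 M := IsManifold.of_le (n := ∞) (by simp)
  have hσ : Continuous (fun z : e.baseSet × Metric.sphere (0 : EuclideanSpace ℝ (Fin n)) 1 =>
      (⟨z.1, (e.continuousLinearEquivAt ℝ z.1.1 z.1.2).symm z.2.1⟩ : TangentBundle (𝓡 n) M)) := by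
    have h1 : Continuous (fun z : e.baseSet × Metric.sphere (0 : EuclideanSpace ℝ (Fin n)) 1 =>
        e.toOpenPartialHomeomorph.symm ((z.1 : M), (z.2 : EuclideanSpace ℝ (Fin n)))) := by
      refine e.toOpenPartialHomeomorph.continuousOn_symm.comp_continuous (by fun_prop) ?_
      rintro ⟨⟨z, hz⟩, v⟩
      rw [e.target_eq]
      exact ⟨hz, mem_univ _⟩
    refine h1.congr fun z => ?_
    exact e.symm_apply_eq_mk_continuousLinearEquivAt_symm (R := ℝ) _ z.1.2 _
  have hcont : Continuous (fun x : e.baseSet => conorm (mfderiv (𝓡 n) (𝓡 n) f x)) := by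
    have hN := continuous_norm_tangentBundle (n := n) (M := M)
    have h1 := (hN.comp ((hf.continuous_tangentMap le_rfl).comp hσ)).div (hN.comp hσ) (by
      rintro ⟨⟨z, hz⟩, v, hv⟩
      have hv1 : ‖v‖ = 1 := by simpa using hv
      refine norm_ne_zero_iff.2 ?_
      change (e.continuousLinearEquivAt ℝ z hz).symm v ≠ 0
      rw [Ne, map_eq_zero_iff _ (ContinuousLinearEquiv.injective _)]
      rintro rfl
      simp at hv1)
    have h2 := IsCompact.continuous_sInf
      (f := fun (x : e.baseSet) (v : Metric.sphere (0 : EuclideanSpace ℝ (Fin n)) 1) =>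
        ‖mfderiv (𝓡 n) (𝓡 n) f x ((e.continuousLinearEquivAt ℝ x.1 x.2).symm v.1)‖ /
          ‖(e.continuousLinearEquivAt ℝ x.1 x.2).symm v.1‖)
      (isCompact_univ) h1
    refine h2.congr fun x => ?_
    rw [conorm_eq_sInf_ratio _ (e.continuousLinearEquivAt ℝ x.1 x.2).symm, image_univ,
      image_eq_range]
  exact (continuousOn_iff_continuous_domRestrict.2 hcont).continuousAt
    (e.open_baseSet.mem_nhds hx₀)

theorem exp_logConorm (hn : 1 ≤ n) {f : M → M} {x : M} (hx : ¬ IsCriticalPoint n f x) :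
    Real.exp (logConorm n f x) = conorm (mfderiv (𝓡 n) (𝓡 n) f x) :=
  Real.exp_log ((not_isCriticalPoint_iff_conorm_pos hn).1 hx)

theorem continuousAt_logConorm (hn : 1 ≤ n)
    [IsContinuousRiemannianBundle (EuclideanSpace ℝ (Fin n))
      (fun x : M => TangentSpace (𝓡 n) x)] {f : M → M} (hf : ContMDiff (𝓡 n) (𝓡 n) 1 f) {x : M}
    (hx : ¬ IsCriticalPoint n f x) : ContinuousAt (logConorm n f) x :=
  (continuous_conorm_mfderiv hf).continuousAt.log
    ((not_isCriticalPoint_iff_conorm_pos hn).1 hx).ne'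

theorem isOpen_setOf_not_isCriticalPoint (hn : 1 ≤ n)
    [IsContinuousRiemannianBundle (EuclideanSpace ℝ (Fin n))
      (fun x : M => TangentSpace (𝓡 n) x)] {f : M → M} (hf : ContMDiff (𝓡 n) (𝓡 n) 1 f) :
    IsOpen {x | ¬ IsCriticalPoint n f x} := by
  simp only [not_isCriticalPoint_iff_conorm_pos hn]
  exact isOpen_lt continuous_const (continuous_conorm_mfderiv hf)

/-- The derivative of `f^[k]` expands by at least the exponential of the Birkhoff sum. -/
theorem exp_birkhoffSum_mul_norm_le (hn : 1 ≤ n) {f : M → M} (hf : ContMDiff (𝓡 n) (𝓡 n) 1 f)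
    {K : Set M} (hK : MapsTo f K K) (hcrit : ∀ x ∈ K, ¬ IsCriticalPoint n f x) (k : ℕ) :
    ∀ x ∈ K, ∀ v : TangentSpace (𝓡 n) x, Real.exp (birkhoffSum f (logConorm n f) k x) * ‖v‖ ≤
      ‖mfderiv (𝓡 n) (𝓡 n) (f^[k]) x v‖ := by
  induction k with
  | zero =>
    intro x _ v
    simp only [birkhoffSum_zero, Real.exp_zero, one_mul, Function.iterate_zero, mfderiv_id]
    exact le_rfl
  | succ k ih =>
    intro x hx v
    have hd : MDifferentiable (𝓡 n) (𝓡 n) f := hf.mdifferentiable one_ne_zero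
    have hdk : MDifferentiable (𝓡 n) (𝓡 n) f^[k] := by
      clear ih
      induction k with
      | zero => exact mdifferentiable_id
      | succ k ih => rw [Function.iterate_succ]; exact ih.comp hd
    have hcomp : mfderiv (𝓡 n) (𝓡 n) (f^[k + 1]) x v =
        mfderiv (𝓡 n) (𝓡 n) (f^[k]) (f x) (mfderiv (𝓡 n) (𝓡 n) f x v) := by
      rw [Function.iterate_succ, mfderiv_comp x (hdk (f x)) (hd x)]
      rfl
    have h1 := ih (f x) (hK hx) (mfderiv (𝓡 n) (𝓡 n) f x v)
    have h2 := conorm_mul_le (mfderiv (𝓡 n) (𝓡 n) f x) v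
    rw [← exp_logConorm hn (hcrit x hx)] at h2
    refine le_trans ?_ (h1.trans_eq (congrArg norm hcomp.symm))
    rw [birkhoffSum_succ', add_comm, Real.exp_add, mul_assoc]
    gcongr

end Manifold
-- Local inverses and their derivatives
section InverseFunction

variable {n : ℕ} {M : Type*} [TopologicalSpace M] [ChartedSpace (EuclideanSpace ℝ (Fin n)) M]
  [IsManifold (𝓡 n) ∞ M]

/-- The inverse function theorem at a noncritical point. -/
theorem exists_local_inverse {f : M → M} (hf : ContMDiff (𝓡 n) (𝓡 n) 1 f) {x₀ : M}
    (hx₀ : ¬ IsCriticalPoint n f x₀) :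
    ∃ g : M → M, ContMDiffAt (𝓡 n) (𝓡 n) 1 g (f x₀) ∧ g (f x₀) = x₀ ∧
      (∀ᶠ y in 𝓝 (f x₀), f (g y) = y) ∧ ∀ᶠ x in 𝓝 x₀, g (f x) = x := by
  have : IsManifold (𝓡 n) 1 M := IsManifold.of_le (n := ∞) (by simp)
  set ψ := extChartAt (𝓡 n) x₀ with hψ
  set ψ' := extChartAt (𝓡 n) (f x₀) with hψ'
  set F : EuclideanSpace ℝ (Fin n) → EuclideanSpace ℝ (Fin n) := ψ' ∘ f ∘ ψ.symm with hFdef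
  have hF : ContDiffAt ℝ 1 F (ψ x₀) := by
    have := (contMDiffAt_iff.1 (hf x₀)).2
    rwa [ModelWithCorners.Boundaryless.range_eq_univ, contDiffWithinAt_univ] at this
  obtain ⟨A₀, hA₀, hbij⟩ : ∃ A₀ : EuclideanSpace ℝ (Fin n) →L[ℝ] EuclideanSpace ℝ (Fin n),
      HasFDerivWithinAt F A₀ (range (𝓡 n)) (ψ x₀) ∧ Function.Bijective A₀ :=
    ⟨mfderiv (𝓡 n) (𝓡 n) f x₀, ((hf.mdifferentiable one_ne_zero) x₀).hasMFDerivAt.2,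
      not_isCriticalPoint_iff_injective.1 hx₀, not_not.1 hx₀⟩
  rw [ModelWithCorners.Boundaryless.range_eq_univ, hasFDerivWithinAt_univ] at hA₀
  obtain ⟨A, hA⟩ : ∃ A : EuclideanSpace ℝ (Fin n) ≃L[ℝ] EuclideanSpace ℝ (Fin n),
      HasFDerivAt F (A : EuclideanSpace ℝ (Fin n) →L[ℝ] EuclideanSpace ℝ (Fin n)) (ψ x₀) :=
    ⟨(LinearEquiv.ofBijective A₀.toLinearMap hbij).toContinuousLinearEquiv, hA₀⟩
  set G := hF.localInverse hA one_ne_zero with hG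
  have hGdiff : ContDiffAt ℝ 1 G (F (ψ x₀)) := hF.to_localInverse hA one_ne_zero
  have hstrict := hF.hasStrictFDerivAt' hA one_ne_zero
  have hright : ∀ᶠ z in 𝓝 (F (ψ x₀)), F (G z) = z := hstrict.eventually_right_inverse
  have hleft : ∀ᶠ a in 𝓝 (ψ x₀), G (F a) = a := hstrict.eventually_left_inverse
  have hψx : ψ.symm (ψ x₀) = x₀ := extChartAt_to_inv x₀
  have hFx : F (ψ x₀) = ψ' (f x₀) := by simp [hFdef, hψx]
  have hGx : G (ψ' (f x₀)) = ψ x₀ := by rw [← hFx]; exact hleft.self_of_nhds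
  rw [hFx] at hGdiff hright
  have hgx : (ψ.symm ∘ G ∘ ψ') (f x₀) = x₀ := by
    simp only [Function.comp_apply, hGx, hψx]
  have hg : ContMDiffAt (𝓡 n) (𝓡 n) 1 (ψ.symm ∘ G ∘ ψ') (f x₀) := by
    refine ContMDiffAt.comp (I' := 𝓘(ℝ, EuclideanSpace ℝ (Fin n))) (f x₀) ?_
      (hGdiff.contMDiffAt.comp (f x₀) contMDiffAt_extChartAt)
    rw [Function.comp_apply, hGx]
    exact (contMDiffOn_extChartAt_symm x₀).contMDiffAt (extChartAt_target_mem_nhds x₀)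
  refine ⟨ψ.symm ∘ G ∘ ψ', hg, hgx, ?_, ?_⟩
  · have h1 := (continuousAt_extChartAt (I := 𝓡 n) (f x₀)).eventually hright
    have h2 : ContinuousAt (f ∘ (ψ.symm ∘ G ∘ ψ')) (f x₀) :=
      hf.continuous.continuousAt.comp hg.continuousAt
    -- The identity holds in the chart at `f x₀`; injectivity of the chart applies only once `f (g
    -- y)` lies in its source.
    have h3 : ∀ᶠ y in 𝓝 (f x₀), f ((ψ.symm ∘ G ∘ ψ') y) ∈ ψ'.source := by
      refine h2.eventually_mem ?_
      rw [Function.comp_apply, hgx]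
      exact extChartAt_source_mem_nhds _
    filter_upwards [h1, h3, extChartAt_source_mem_nhds (I := 𝓡 n) (f x₀)] with y hy1 hy2 hy3
    exact ψ'.injOn hy2 hy3 hy1
  · have h1 := (continuousAt_extChartAt (I := 𝓡 n) x₀).eventually hleft
    filter_upwards [h1, extChartAt_source_mem_nhds (I := 𝓡 n) x₀] with x hx1 hx2
    have hx3 : ψ.symm (ψ x) = x := ψ.left_inv hx2
    change G (ψ' (f (ψ.symm (ψ x)))) = ψ x at hx1
    rw [hx3] at hx1
    simp only [Function.comp_apply, hx1, hx3]

end InverseFunction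

/-- The derivative of `f ∘ g` takes values in the tangent space at `f (g y)`, which is equal to the
one at `y` only propositionally. -/
theorem norm_tangentSpace_congr {n : ℕ} {M : Type*} [TopologicalSpace M]
    [ChartedSpace (EuclideanSpace ℝ (Fin n)) M]
    [RiemannianBundle (fun x : M => TangentSpace (𝓡 n) x)] {x y : M} (h : x = y)
    (w : EuclideanSpace ℝ (Fin n)) :
    @norm (TangentSpace (𝓡 n) x) _ w = @norm (TangentSpace (𝓡 n) y) _ w := by
  rw [h]

section Derivative

variable {n : ℕ} {M : Type*} [TopologicalSpace M] [ChartedSpace (EuclideanSpace ℝ (Fin n)) M]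
  [IsManifold (𝓡 n) ∞ M] [RiemannianBundle (fun x : M => TangentSpace (𝓡 n) x)]

/-- Differentiating `f ∘ g = id` turns the lower bound given by the co-norm of Df into an upper
bound for Dg. -/
theorem norm_mfderiv_local_inverse_le (hn : 1 ≤ n) {f g : M → M}
    (hf : ContMDiff (𝓡 n) (𝓡 n) 1 f) {y : M} (hg : MDifferentiableAt (𝓡 n) (𝓡 n) g y)
    (hfg : ∀ᶠ z in 𝓝 y, f (g z) = z) (hcrit : ¬ IsCriticalPoint n f (g y))
    (v : TangentSpace (𝓡 n) y) :
    ‖mfderiv (𝓡 n) (𝓡 n) g y v‖ ≤ Real.exp (-logConorm n f (g y)) * ‖v‖ := by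
  have h1 : mfderiv (𝓡 n) (𝓡 n) (f ∘ g) y =
      (mfderiv (𝓡 n) (𝓡 n) f (g y)) ∘L (mfderiv (𝓡 n) (𝓡 n) g y) :=
    mfderiv_comp y (hf.mdifferentiable one_ne_zero _) hg
  have h2 : mfderiv (𝓡 n) (𝓡 n) (f ∘ g) y = mfderiv (𝓡 n) (𝓡 n) id y :=
    Filter.EventuallyEq.mfderiv_eq hfg
  have h3 : (mfderiv (𝓡 n) (𝓡 n) f (g y)) (mfderiv (𝓡 n) (𝓡 n) g y v) =
      (v : EuclideanSpace ℝ (Fin n)) := by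
    have h4 : (mfderiv (𝓡 n) (𝓡 n) (f ∘ g) y : EuclideanSpace ℝ (Fin n) →L[ℝ] _) v = v := by
      rw [h2, mfderiv_id]; rfl
    rw [h1] at h4
    exact h4
  have h5 := conorm_mul_le (mfderiv (𝓡 n) (𝓡 n) f (g y)) (mfderiv (𝓡 n) (𝓡 n) g y v)
  rw [h3, ← exp_logConorm hn hcrit] at h5
  have h6 := h5.trans_eq (norm_tangentSpace_congr hfg.self_of_nhds v)
  rw [Real.exp_neg, le_inv_mul_iff₀ (Real.exp_pos _)]
  exact h6

end Derivative

/-! ### From derivative bounds to uniform Lipschitz inverse branches -/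

section Riemannian

variable {n : ℕ} {M : Type*} [EMetricSpace M] [ChartedSpace (EuclideanSpace ℝ (Fin n)) M]
  [IsManifold (𝓡 n) ∞ M] [RiemannianBundle (fun x : M => TangentSpace (𝓡 n) x)]
  [IsRiemannianManifold (𝓡 n) M]

/-- A map whose derivative is bounded by `L` on a ball is `L`-Lipschitz on the concentric ball of
a third of the radius. -/
theorem lipschitzOnWith_of_norm_mfderiv_le {g : M → M} {L : NNReal} (hL0 : L ≠ 0) {b : M}
    {r : ENNReal} (hg : ContMDiffOn (𝓡 n) (𝓡 n) 1 g (Metric.eball b (3 * r)))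
    (hL : ∀ y ∈ Metric.eball b (3 * r), ∀ v : TangentSpace (𝓡 n) y,
      ‖mfderiv (𝓡 n) (𝓡 n) g y v‖ₑ ≤ L * ‖v‖ₑ) :
    LipschitzOnWith L g (Metric.eball b r) := by
  have : IsManifold (𝓡 n) 1 M := IsManifold.of_le (n := ∞) (by simp)
  intro y hy z hz
  rw [mul_comm, ← ENNReal.div_le_iff_le_mul (by simp [hL0]) (by simp)]
  refine le_of_forall_gt fun R hR => ?_
  have hyz : edist y z < r + r :=
    (edist_triangle_right y z b).trans_lt (ENNReal.add_lt_add hy hz)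
  have hd := lt_min hR hyz
  rw [IsRiemannianManifold.out (I := 𝓡 n) y z] at hd
  obtain ⟨γ, h0, h1, hγ, hlen⟩ := exists_lt_of_riemannianEDist_lt hd
  -- A path from `y` of length below `2r` stays in the `3r`-ball, where the derivative bound holds.
  have hin : MapsTo γ (Icc 0 1) (Metric.eball b (3 * r)) := by
    intro t ht
    have h2 : edist y (γ t) < r + r := by
      rw [IsRiemannianManifold.out (I := 𝓡 n) y (γ t)]
      refine (riemannianEDist_le_pathELength (hγ.mono (Icc_subset_Icc_right ht.2)) h0 rfl
        ht.1).trans_lt ?_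
      exact (pathELength_mono le_rfl ht.2).trans_lt (hlen.trans_le (min_le_right _ _))
    rw [Metric.mem_eball, edist_comm]
    calc edist b (γ t) ≤ edist b y + edist y (γ t) := edist_triangle _ _ _
      _ < r + (r + r) := ENNReal.add_lt_add (by rw [edist_comm]; exact hy) h2
      _ = 3 * r := by ring
  have hcomp : ContMDiffOn 𝓘(ℝ, ℝ) (𝓡 n) 1 (g ∘ γ) (Icc 0 1) := hg.comp hγ hin
  have hle : pathELength (𝓡 n) (g ∘ γ) 0 1 ≤ L * pathELength (𝓡 n) γ 0 1 := by
    rw [pathELength_eq_lintegral_mfderivWithin_Icc, pathELength_eq_lintegral_mfderivWithin_Icc,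
      ← MeasureTheory.lintegral_const_mul' _ _ ENNReal.coe_ne_top]
    refine MeasureTheory.setLIntegral_mono' measurableSet_Icc fun t ht => ?_
    have hchain : mfderivWithin 𝓘(ℝ, ℝ) (𝓡 n) (g ∘ γ) (Icc 0 1) t =
        (mfderiv (𝓡 n) (𝓡 n) g (γ t)) ∘L (mfderivWithin 𝓘(ℝ, ℝ) (𝓡 n) γ (Icc 0 1) t) := by
      apply mfderiv_comp_mfderivWithin
      · exact (hg.contMDiffAt (Metric.isOpen_eball.mem_nhds (hin ht))).mdifferentiableAt
          one_ne_zero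
      · exact hγ.mdifferentiableOn one_ne_zero t ht
      · rw [uniqueMDiffWithinAt_iff_uniqueDiffWithinAt]
        exact uniqueDiffOn_Icc zero_lt_one t ht
    have hchain1 : mfderivWithin 𝓘(ℝ, ℝ) (𝓡 n) (g ∘ γ) (Icc 0 1) t 1 =
        (mfderiv (𝓡 n) (𝓡 n) g (γ t)) (mfderivWithin 𝓘(ℝ, ℝ) (𝓡 n) γ (Icc 0 1) t 1) :=
      by rw [hchain]; rfl
    rw [hchain1]
    exact hL _ (hin ht) _
  have hdist : edist (g y) (g z) ≤ L * pathELength (𝓡 n) γ 0 1 := by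
    rw [IsRiemannianManifold.out (I := 𝓡 n) (g y) (g z)]
    exact (riemannianEDist_le_pathELength hcomp (by simp [h0]) (by simp [h1])
      zero_le_one).trans hle
  calc edist (g y) (g z) / L ≤ pathELength (𝓡 n) γ 0 1 := by
        rw [ENNReal.div_le_iff_le_mul (by simp [hL0]) (by simp), mul_comm]
        exact hdist
    _ < R := hlen.trans_le (min_le_left _ _)

/-- Uniform local inverse branches along a compact set without critical points. -/
theorem exists_inverse_branches (hn : 1 ≤ n)
    [IsContinuousRiemannianBundle (EuclideanSpace ℝ (Fin n))
      (fun x : M => TangentSpace (𝓡 n) x)] {f : M → M} (hf : ContMDiff (𝓡 n) (𝓡 n) 1 f)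
    {K : Set M} (hK : IsCompact K) (hcrit : ∀ x ∈ K, ¬ IsCriticalPoint n f x) {ε : ℝ}
    (hε : 0 < ε) :
    ∃ δ : ENNReal, 0 < δ ∧ ∀ x ∈ K, ∃ g : M → M, g (f x) = x ∧
      LipschitzOnWith (Real.toNNReal (Real.exp (-(logConorm n f x - ε)))) g
        (Metric.eball (f x) δ) ∧
      ∀ y ∈ Metric.eball (f x) δ, f (g y) = y := by
  have : IsManifold (𝓡 n) 1 M := IsManifold.of_le (n := ∞) (by simp)
  refine hK.induction_on (p := fun s => ∃ δ : ENNReal, 0 < δ ∧ ∀ x ∈ s, ∃ g : M → M,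
    g (f x) = x ∧ LipschitzOnWith (Real.toNNReal (Real.exp (-(logConorm n f x - ε)))) g
        (Metric.eball (f x) δ) ∧ ∀ y ∈ Metric.eball (f x) δ, f (g y) = y) ⟨1, by simp⟩ ?_ ?_ ?_
  · rintro s t hst ⟨δ, hδ, h⟩
    exact ⟨δ, hδ, fun x hx => h x (hst hx)⟩
  · rintro s t ⟨δ, hδ, h⟩ ⟨δ', hδ', h'⟩
    refine ⟨min δ δ', lt_min hδ hδ', ?_⟩
    rintro x (hx | hx)
    · obtain ⟨g, h1, h2, h3⟩ := h x hx
      have hsub := Metric.eball_subset_eball (x := f x) (min_le_left δ δ')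
      exact ⟨g, h1, h2.mono hsub, fun y hy => h3 y (hsub hy)⟩
    · obtain ⟨g, h1, h2, h3⟩ := h' x hx
      have hsub := Metric.eball_subset_eball (x := f x) (min_le_right δ δ')
      exact ⟨g, h1, h2.mono hsub, fun y hy => h3 y (hsub hy)⟩
  · intro x₀ hx₀
    have hφ := continuousAt_logConorm hn hf (hcrit x₀ hx₀)
    obtain ⟨g, hg, hgx, hfg, hgf⟩ := exists_local_inverse hf (hcrit x₀ hx₀)
    obtain ⟨u, hu, hgu⟩ := (contMDiffAt_iff_contMDiffOn_nhds (by simp)).1 hg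
    -- Half of `ε` pays for moving `g y` away from `x₀`; the other half, in `h2` below, replaces the
    -- value at `x₀` by that at `x`.
    have hlow : ∀ᶠ y in 𝓝 (f x₀), logConorm n f x₀ - ε / 2 < logConorm n f (g y) := by
      have h1 : ContinuousAt (logConorm n f) (g (f x₀)) := by rwa [hgx]
      have h2 : ContinuousAt (logConorm n f ∘ g) (f x₀) := h1.comp hg.continuousAt
      refine h2.eventually (lt_mem_nhds ?_)
      rw [Function.comp_apply, hgx]
      linarith
    have hnc : ∀ᶠ y in 𝓝 (f x₀), ¬ IsCriticalPoint n f (g y) := by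
      refine hg.continuousAt.eventually_mem
        ((isOpen_setOf_not_isCriticalPoint hn hf).mem_nhds ?_)
      rw [hgx]
      exact hcrit x₀ hx₀
    have huev : ∀ᶠ y in 𝓝 (f x₀), y ∈ u := hu
    obtain ⟨R, hR, hsub⟩ := EMetric.mem_nhds_iff.1 (huev.and (hfg.and (hlow.and hnc)))
    obtain ⟨r, hr0, hrR⟩ : ∃ r : ENNReal, 0 < r ∧ 3 * r ≤ R :=
      ⟨R / 3, ENNReal.div_pos hR.ne' (by simp), ENNReal.mul_div_le⟩
    have hsub' : ∀ y ∈ Metric.eball (f x₀) (3 * r), y ∈ u ∧ f (g y) = y ∧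
        logConorm n f x₀ - ε / 2 < logConorm n f (g y) ∧ ¬ IsCriticalPoint n f (g y) :=
      fun y hy => hsub (Metric.eball_subset_eball hrR hy)
    have hdiff : ContMDiffOn (𝓡 n) (𝓡 n) 1 g (Metric.eball (f x₀) (3 * r)) :=
      hgu.mono fun y hy => (hsub' y hy).1
    have hlip : LipschitzOnWith (Real.toNNReal (Real.exp (-(logConorm n f x₀ - ε / 2)))) g
        (Metric.eball (f x₀) r) := by
      refine lipschitzOnWith_of_norm_mfderiv_le
        (by simpa using Real.exp_pos _) hdiff fun y hy v => ?_
      have hnear : Metric.eball (f x₀) (3 * r) ∈ 𝓝 y := Metric.isOpen_eball.mem_nhds hy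
      have h1 := norm_mfderiv_local_inverse_le hn hf
        ((hdiff.contMDiffAt hnear).mdifferentiableAt one_ne_zero)
        (Filter.mem_of_superset hnear fun z hz => (hsub' z hz).2.1) (hsub' y hy).2.2.2 v
      have h2 : ‖mfderiv (𝓡 n) (𝓡 n) g y v‖ ≤
          Real.exp (-(logConorm n f x₀ - ε / 2)) * ‖v‖ := by
        refine h1.trans ?_
        gcongr
        exact (hsub' y hy).2.2.1.le
      rw [← ofReal_norm, ← ofReal_norm]
      refine (ENNReal.ofReal_le_ofReal h2).trans_eq ?_
      rw [ENNReal.ofReal_mul (Real.exp_pos _).le]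
      rfl
    have h1 : ∀ᶠ x in 𝓝 x₀, f x ∈ Metric.eball (f x₀) (min r 1 / 2) :=
      hf.continuous.continuousAt.eventually_mem (Metric.eball_mem_nhds _
        (ENNReal.half_pos (lt_min hr0 one_pos).ne'))
    have h2 : ∀ᶠ x in 𝓝 x₀, logConorm n f x < logConorm n f x₀ + ε / 2 :=
      hφ.eventually (gt_mem_nhds (by linarith))
    refine ⟨_, mem_nhdsWithin_of_mem_nhds (h1.and (h2.and hgf)), min r 1 / 2,
      ENNReal.half_pos (lt_min hr0 one_pos).ne', ?_⟩
    rintro x ⟨hx1, hx2, hx3⟩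
    have hball : Metric.eball (f x) (min r 1 / 2) ⊆ Metric.eball (f x₀) r := by
      intro y hy
      rw [Metric.mem_eball]
      calc edist y (f x₀) ≤ edist y (f x) + edist (f x) (f x₀) := edist_triangle _ _ _
        _ < min r 1 / 2 + min r 1 / 2 := ENNReal.add_lt_add hy hx1
        _ = min r 1 := ENNReal.add_halves _
        _ ≤ r := min_le_left _ _
    refine ⟨g, hx3, (hlip.mono hball).weaken ?_, fun y hy => ?_⟩
    · refine Real.toNNReal_le_toNNReal (Real.exp_le_exp.2 ?_)
      linarith
    · refine (hsub' y (Metric.eball_subset_eball ?_ (hball hy))).2.1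
      exact le_mul_of_one_le_left' (by norm_num)

end Riemannian

/-! ### The dichotomy on the manifold -/

/-- Either `f` is uniformly expanding on a compact forward invariant set without critical points,
or some point of it has averages at most `a₀` at all times. -/
theorem uniformlyExpandingOn_or_exists_bad_point {n : ℕ} (hn : 1 ≤ n) {M : Type*}
    [TopologicalSpace M] [ChartedSpace (EuclideanSpace ℝ (Fin n)) M] [IsManifold (𝓡 n) ∞ M]
    [RiemannianBundle (fun x : M => TangentSpace (𝓡 n) x)]
    [IsContinuousRiemannianBundle (EuclideanSpace ℝ (Fin n))
      (fun x : M => TangentSpace (𝓡 n) x)]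
    {f : M → M} (hf : ContMDiff (𝓡 n) (𝓡 n) 1 f) {K : Set M} (hK : IsCompact K)
    (hfK : MapsTo f K K) (hcrit : ∀ x ∈ K, ¬ IsCriticalPoint n f x) {a₀ : ℝ} (ha₀ : 0 < a₀) :
    UniformlyExpandingOn n f K ∨
      ∃ x ∈ K, ∀ k : ℕ, 1 ≤ k → birkhoffSum f (logConorm n f) k x ≤ k * a₀ := by
  by_contra! hcon
  obtain ⟨hne, hgrow⟩ := hcon
  obtain ⟨D, hD⟩ := exists_uniform_growth hf.continuous hK hfK
    (fun x hx => continuousAt_logConorm hn hf (hcrit x hx)) ha₀ hgrow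
  refine hne ⟨Real.exp (-D), Real.exp_pos _, a₀, ha₀, fun x hx v k _ => ?_⟩
  refine le_trans ?_ (exp_birkhoffSum_mul_norm_le hn hf hfK hcrit k x hx v)
  rw [mul_right_comm, ← Real.exp_add]
  gcongr
  linarith [hD x hx k]

/-- In the presence of a point with small averages, there are periodic orbits close to `Lam` with
prescribed intermediate exponents. -/
theorem exists_periodic_orbit_of_bad_point {n : ℕ} (hn : 1 ≤ n) {M : Type*} [EMetricSpace M]
    [CompactSpace M] [ChartedSpace (EuclideanSpace ℝ (Fin n)) M] [IsManifold (𝓡 n) ∞ M]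
    [RiemannianBundle (fun x : M => TangentSpace (𝓡 n) x)]
    [IsContinuousRiemannianBundle (EuclideanSpace ℝ (Fin n))
      (fun x : M => TangentSpace (𝓡 n) x)] [IsRiemannianManifold (𝓡 n) M]
    {f : M → M} (hf : ContMDiff (𝓡 n) (𝓡 n) 1 f)
    {Lam : Set M} (hinv : MapsTo f Lam Lam) (hper : Lam ⊆ Function.periodicPts f)
    (hcrit : ∀ x ∈ closure Lam, ¬ IsCriticalPoint n f x) {c : ℝ}
    (hexp : ∀ x ∈ Lam, c ≤ limsup (fun k : ℕ =>
      (1 / (k : ℝ)) * ∑ i ∈ Finset.range k, logConorm n f (f^[i] x)) atTop)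
    {V : Set M} (hV : V ∈ 𝓝ˢ (closure Lam)) {a₀ γ' γ'' : ℝ} (hγ' : 0 < γ') (ha₀ : a₀ < γ')
    (hγ : γ' < γ'') (hγ'' : γ'' < c) (T : ℕ) {x₀ : M} (hx₀ : x₀ ∈ closure Lam)
    (hbad : ∀ k : ℕ, 1 ≤ k → birkhoffSum f (logConorm n f) k x₀ ≤ k * a₀) :
    ∃ p ∈ Function.periodicPts f, ∃ τ : ℕ, τ = Function.minimalPeriod f p ∧ T ≤ τ ∧
      (∀ i : ℕ, f^[i] p ∈ V ∧ ¬ IsCriticalPoint n f (f^[i] p)) ∧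
      (1 / (τ : ℝ)) * ∑ i ∈ Finset.range τ, logConorm n f (f^[i] p) < γ'' ∧
      ∀ k : ℕ, 1 ≤ k → k ≤ τ →
        γ' < (1 / (k : ℝ)) * ∑ i ∈ Finset.Icc 1 k, logConorm n f (f^[τ - i] p) := by
  -- Shrinking `V` to the open noncritical set makes the periodic orbit avoid critical points.
  have hV' : V ∩ {x | ¬ IsCriticalPoint n f x} ∈ 𝓝ˢ (closure Lam) :=
    inter_mem hV ((isOpen_setOf_not_isCriticalPoint hn hf).mem_nhdsSet.2 hcrit)
  obtain ⟨a₁, ha₁, p, τ, hτ, hp, hpV, hgood, hsum, j, hj⟩ :=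
    exists_periodic_of_bad_point (φ := logConorm n f) hf.continuous hinv
      (fun x hx => continuousAt_logConorm hn hf (hcrit x hx))
      (fun x hx => by
        obtain ⟨m, hm, hxm⟩ := hper hx
        exact ⟨m, hm, hxm, mul_le_birkhoffSum_of_le_limsup hm hxm (hexp x hx)⟩)
      (fun ε hε => exists_inverse_branches hn hf isClosed_closure.isCompact hcrit hε)
      hγ' ha₀ hγ hγ'' hx₀ hbad hV' T
  obtain ⟨h1, h2, h3, h4, h5⟩ := minimalPeriod_estimates ha₁ hτ hp hpV hgood hsum hj
  exact ⟨p, h1, _, rfl, h2, h3, h4, h5⟩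

end C1Endo

theorem theorem4p1 {n : ℕ} (hn : 1 ≤ n) {M : Type*} [TopologicalSpace M] [T2Space M]
    [CompactSpace M] [ChartedSpace (EuclideanSpace ℝ (Fin n)) M] [IsManifold (𝓡 n) ∞ M]
    [RiemannianBundle (fun x : M => TangentSpace (𝓡 n) x)]
    [IsContMDiffRiemannianBundle (𝓡 n) ∞ (EuclideanSpace ℝ (Fin n))
      (fun x : M => TangentSpace (𝓡 n) x)]
    (f : M → M) (hf : ContMDiff (𝓡 n) (𝓡 n) 1 f)
    (Lam : Set M) (hinv : MapsTo f Lam Lam) (hper : Lam ⊆ Function.periodicPts f)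
    (hcrit : ∀ x ∈ closure Lam, ¬ C1Endo.IsCriticalPoint n f x)
    (c : ℝ) (hc : 0 < c)
    (hexp : ∀ x ∈ Lam, c ≤ limsup (fun k : ℕ =>
      (1 / (k : ℝ)) * ∑ i ∈ Finset.range k, C1Endo.logConorm n f (f^[i] x)) atTop) :
    C1Endo.UniformlyExpandingOn n f (closure Lam) ∨
    ∀ V ∈ 𝓝ˢ (closure Lam), ∀ γ' γ'' : ℝ, 0 < γ' → γ' < γ'' → γ'' < c → ∀ T : ℕ,
      ∃ p ∈ Function.periodicPts f, ∃ τ : ℕ, τ = Function.minimalPeriod f p ∧ T ≤ τ ∧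
        (∀ i : ℕ, f^[i] p ∈ V ∧ ¬ C1Endo.IsCriticalPoint n f (f^[i] p)) ∧
        (1 / (τ : ℝ)) * ∑ i ∈ Finset.range τ, C1Endo.logConorm n f (f^[i] p) < γ'' ∧
        ∀ k : ℕ, 1 ≤ k → k ≤ τ →
          γ' < (1 / (k : ℝ)) * ∑ i ∈ Finset.Icc 1 k, C1Endo.logConorm n f (f^[τ - i] p) := by
  have : IsContinuousRiemannianBundle (EuclideanSpace ℝ (Fin n))
      (fun x : M => TangentSpace (𝓡 n) x) := C1Endo.isContinuousRiemannianBundle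
  have : IsManifold (𝓡 n) 1 M := IsManifold.of_le (n := ∞) (by simp)
  refine or_iff_not_imp_left.2 fun hne V hV γ' γ'' hγ' hγ hγ'' T => ?_
  -- The threshold `γ' / 2` is positive, so it can be an expansion rate, and below `γ'`, which
  -- leaves room for shadowing.
  obtain ⟨x₀, hx₀, hbad⟩ := (C1Endo.uniformlyExpandingOn_or_exists_bad_point hn hf
    isClosed_closure.isCompact (hinv.closure hf.continuous) hcrit
    (half_pos hγ')).resolve_left hne
  -- Distances are extended-valued because `M` need not be connected.
  let : EMetricSpace M := EMetricSpace.ofRiemannianMetric (𝓡 n) M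
  have : IsRiemannianManifold (𝓡 n) M := ⟨fun _ _ => rfl⟩
  exact C1Endo.exists_periodic_orbit_of_bad_point hn hf hinv hper hcrit hexp hV hγ'
    (half_lt_self hγ') hγ hγ'' T hx₀ hbad
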